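/- Let $\mathcal S$ be a $\delta$-ring on a set $S$: a ring of subsets of $S$ that is closed under countable intersections and contains a sequence of sets covering $S$; let $\sigma(\mathcal S)$ be the $\sigma$-algebra it generates. Let $(\Omega,\mathcal A,\mathbb P)$ be a probability space and let $M$ assign to each $A\in\mathcal S$ a random vector $M(A)$ in $\mathbb R^m$ such that $M(A_1),\dots,M(A_k)$ are independent whenever $A_1,\dots,A_k\in\mathcal S$ are disjoint, and $M(\bigcup_n A_n)=\sum_{n=1}^\infty M(A_n)$ almost surely whenever $(A_n)\subset\mathcal S$ are disjoint with $\bigcup_n A_n\in\mathcal S$ (an independently scattered random measure). For $\gamma\in\mathbb R^m$, an $m\times m$ matrix $Q$ and a measure $\phi$ on $\mathbb R^m$ put $$\psi_{[\gamma,Q,\phi]}(t)=i\langle\gamma,t\rangle-\tfrac12\langle Qt,t\rangle+\int_{\mathbb R^m}\Big(e^{i\langle t,x\rangle}-1-\frac{i\langle t,x\rangle}{1+\|x\|^2}\Big)\phi(dx),\qquad t\in\mathbb R^m .$$ Assume that for each $A\in\mathcal S$ the law of $M(A)$ is infinitely divisible with triplet $[\gamma_A,Q_A,\phi_A]$, that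 is, $Q_A$ is symmetric positive semidefinite, $\phi_A(\{0\})=0$, $\int\min\{1,\|x\|^2\}\,\phi_A(dx)<\infty$, and its characteristic function is $\exp\psi_{[\gamma_A,Q_A,\phi_A]}$. Then there is a unique measure $\lambda_M$ on $\sigma(\mathcal S)$ (the control measure; it is $\sigma$-finite) with $$\lambda_M(A)=|\gamma|_A+\operatorname{tr}(Q_A)+\int_{\mathbb R^m}\min\{1,\|x\|^2\}\,\phi_A(dx),\qquad A\in\mathcal S,$$ where $|\gamma|_A$ is the supremum of $\sum_{j=1}^n\|\gamma_{A_j}\|$ over all $n$ and all disjoint $A_1,\dots,A_n\in\mathcal S$ contained in $A$. There is also a transition function $\rho_M$ from $(S,\sigma(\mathcal S))$ to $\mathbb R^m$ with $\int_A\rho_M(s,B)\,\lambda_M(ds)=\phi_A(B)$ for all $A\in\mathcal S$ and all Borel sets $B$, such that $\mathbb R^m$ is a countable union of Borel sets $B_n$ with $\sup_{s}\rho_M(s,B_n)<\infty$ for every $n$; it can be chosen with $\int\min\{1,\|x\|^2\}\,\rho_M(s,dx)\le1$ for all $s\in S$. Fix any such $\rho_M$. Moreover: (i) There are $\sigma(\mathcal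 S)$-measurable maps $\alpha_M:S\to\mathbb R^m$ and $\beta_M:S\to L(\mathbb R^m)=\mathbb R^{m\times m}$ such that, for every $A\in\mathcal S$, the following integrals exist component-wise and $$\int_A\alpha_M(s)\,\lambda_M(ds)=\gamma_A,\qquad\int_A\beta_M(s)\,\lambda_M(ds)=Q_A .$$ Each of $\alpha_M$ and $\beta_M$ is determined $\lambda_M$-a.e. by this property. (ii) $\beta_M(s)$ is symmetric and positive semidefinite for $\lambda_M$-a.e. $s$. (iii) Put $K_M(t,s)=\psi_{[\alpha_M(s),\beta_M(s),\rho_M(s,\cdot)]}(t)$; for $\lambda_M$-a.e. $s$ the integral in this definition exists for all $t\in\mathbb R^m$. For every $A\in\mathcal S$ and $t\in\mathbb R^m$ the function $K_M(t,\cdot)$ is $\lambda_M$-integrable over $A$, and $t\mapsto\int_AK_M(t,s)\,\lambda_M(ds)$ is the log-characteristic function of $M(A)$: it is continuous, vanishes at $t=0$, and its exponential is the characteristic function of $M(A)$. -/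

import Mathlib

open MeasureTheory ProbabilityTheory Filter
open scoped ENNReal NNReal Topology

noncomputable section

namespace ISRM

/-- A `δ`-ring on `S`: a ring of sets which is closed under countable intersections and contains
a sequence of sets that covers `S`. -/
structure IsDeltaRing {S : Type*} (𝒮 : Set (Set S)) : Prop where
  isSetRing : IsSetRing 𝒮
  iInter_mem : ∀ A : ℕ → Set S, (∀ n, A n ∈ 𝒮) → (⋂ n, A n) ∈ 𝒮
  exists_cover : ∃ A : ℕ → Set S, (∀ n, A n ∈ 𝒮) ∧ (⋃ n, A n) = Set.univ

/-- An independently scattered random measure on `𝒮` with values in `ℝᵐ`. Only the values `M A`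
with `A ∈ 𝒮` matter. The series in `sigma_additive` converges in the given order. -/
structure IsISRM {S Ω : Type*} [MeasurableSpace Ω] {m : ℕ} (𝒮 : Set (Set S)) (P : Measure Ω)
    (M : Set S → Ω → EuclideanSpace ℝ (Fin m)) : Prop where
  measurable : ∀ A ∈ 𝒮, Measurable (M A)
  indep : ∀ (k : ℕ) (A : Fin k → Set S), (∀ i, A i ∈ 𝒮) →
    Pairwise (fun i j => Disjoint (A i) (A j)) → iIndepFun (fun i => M (A i)) P
  sigma_additive : ∀ A : ℕ → Set S, (∀ n, A n ∈ 𝒮) →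
    Pairwise (fun i j => Disjoint (A i) (A j)) → (⋃ n, A n) ∈ 𝒮 →
    ∀ᵐ ω ∂P, Tendsto (fun N : ℕ => ∑ n ∈ Finset.range N, M (A n) ω) atTop
      (𝓝 (M (⋃ n, A n) ω))

/-- The integrand `e^{i⟨t,x⟩} - 1 - i⟨t,x⟩ / (1 + ‖x‖²)`. -/
def levyIntegrand {m : ℕ} (t x : EuclideanSpace ℝ (Fin m)) : ℂ :=
  Complex.exp (Complex.I * ((inner ℝ t x : ℝ) : ℂ)) - 1
    - Complex.I * ((inner ℝ t x : ℝ) : ℂ) / ((1 + ‖x‖ ^ 2 : ℝ) : ℂ)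

/-- The Lévy–Khintchine exponent of the triplet `[γ, Q, φ]`. -/
def levyKhintchineExponent {m : ℕ} (γ : EuclideanSpace ℝ (Fin m)) (Q : Matrix (Fin m) (Fin m) ℝ)
    (φ : Measure (EuclideanSpace ℝ (Fin m))) (t : EuclideanSpace ℝ (Fin m)) : ℂ :=
  Complex.I * ((inner ℝ γ t : ℝ) : ℂ)
    - (1 / 2 : ℂ) * ((inner ℝ (Matrix.toEuclideanLin Q t) t : ℝ) : ℂ)
    + ∫ x, levyIntegrand t x ∂φ

/-- The integral `∫ min {1, ‖x‖²} φ(dx)`, with values in `[0, ∞]`. -/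
def truncatedSecondMoment {m : ℕ} (φ : Measure (EuclideanSpace ℝ (Fin m))) : ℝ≥0∞ :=
  ∫⁻ x, ENNReal.ofReal (min 1 (‖x‖ ^ 2)) ∂φ

/-- A Lévy measure on `ℝᵐ`. -/
structure IsLevyMeasure {m : ℕ} (φ : Measure (EuclideanSpace ℝ (Fin m))) : Prop where
  zero : φ {0} = 0
  moment_lt_top : truncatedSecondMoment φ < ∞

/-- `μ ∼ [γ, Q, φ]`: the distribution `μ` on `ℝᵐ` is infinitely divisible with Lévy–Khintchine
triplet `[γ, Q, φ]`. For a real matrix, `Q.PosSemidef` says that `Q` is symmetric and positive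
semi-definite. -/
structure HasLevyTriplet {m : ℕ} (μ : Measure (EuclideanSpace ℝ (Fin m)))
    (γ : EuclideanSpace ℝ (Fin m)) (Q : Matrix (Fin m) (Fin m) ℝ)
    (φ : Measure (EuclideanSpace ℝ (Fin m))) : Prop where
  posSemidef : Q.PosSemidef
  isLevyMeasure : IsLevyMeasure φ
  charFun_eq : ∀ t, charFun μ t = Complex.exp (levyKhintchineExponent γ Q φ t)

/-- `ψ` is the log-characteristic function of `μ`: the (only) continuous function with `ψ 0 = 0`
whose exponential is the characteristic function of `μ`. -/
structure IsLogCharFun {m : ℕ} (μ : Measure (EuclideanSpace ℝ (Fin m)))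
    (ψ : EuclideanSpace ℝ (Fin m) → ℂ) : Prop where
  continuous : Continuous ψ
  map_zero : ψ 0 = 0
  charFun_eq : ∀ t, charFun μ t = Complex.exp (ψ t)

/-- The total variation `|T|(A)` of a set function `T` on `𝒮`, with values in `[0, ∞]`. -/
def totalVariation {S V : Type*} [NormedAddCommGroup V] (𝒮 : Set (Set S)) (T : Set S → V)
    (A : Set S) : ℝ≥0∞ :=
  ⨆ (n : ℕ) (B : Fin n → Set S) (_ : ∀ j, B j ∈ 𝒮 ∧ B j ⊆ A)
    (_ : Pairwise (fun i j => Disjoint (B i) (B j))), ∑ j, ‖T (B j)‖ₑ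

/-- `lam` satisfies the equation that determines the control measure of a random measure with
triplets `[γ A, Q A, φ A]`, `A ∈ 𝒮`. -/
def IsControlMeasure {S : Type*} [MeasurableSpace S] {m : ℕ} (𝒮 : Set (Set S))
    (γ : Set S → EuclideanSpace ℝ (Fin m)) (Q : Set S → Matrix (Fin m) (Fin m) ℝ)
    (φ : Set S → Measure (EuclideanSpace ℝ (Fin m))) (lam : Measure S) : Prop :=
  ∀ A ∈ 𝒮, lam A = totalVariation 𝒮 γ A + ENNReal.ofReal (Q A).trace
    + truncatedSecondMoment (φ A)

/-- A simultaneous `σ`-finite transition function: a kernel for which the whole space is a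
countable union of measurable sets on each of which the kernel is bounded uniformly in the first
variable. -/
def IsSimultaneousSigmaFinite {S E : Type*} [MeasurableSpace S] [MeasurableSpace E]
    (κ : Kernel S E) : Prop :=
  ∃ (B : ℕ → Set E) (r : ℕ → ℝ≥0), (∀ n, MeasurableSet (B n)) ∧ (⋃ n, B n) = Set.univ ∧
    ∀ n s, κ s (B n) ≤ r n

/-- `ρ` is a version of the transition function that disintegrates the Lévy measures `φ A` with
respect to `lam`: it is simultaneous `σ`-finite and `(lam ⊙ ρ)(A × B) = φ A B`, where
`(lam ⊙ ρ)(A × B)` is by definition the integral of `ρ(s, B)` over `A`. -/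
structure IsLevyTransition {S : Type*} [MeasurableSpace S] {m : ℕ} (𝒮 : Set (Set S))
    (φ : Set S → Measure (EuclideanSpace ℝ (Fin m))) (lam : Measure S)
    (ρ : Kernel S (EuclideanSpace ℝ (Fin m))) : Prop where
  sigmaFinite : IsSimultaneousSigmaFinite ρ
  lintegral_eq : ∀ A ∈ 𝒮, ∀ B : Set (EuclideanSpace ℝ (Fin m)), MeasurableSet B →
    ∫⁻ s in A, ρ s B ∂lam = φ A B

/-- `α` is measurable, integrable over each `A ∈ 𝒮`, with integral `γ A` (component-wise). -/
structure IsVectorDensity {S : Type*} [MeasurableSpace S] {m : ℕ} (𝒮 : Set (Set S))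
    (lam : Measure S) (γ : Set S → EuclideanSpace ℝ (Fin m))
    (α : S → EuclideanSpace ℝ (Fin m)) : Prop where
  measurable : Measurable α
  integrableOn : ∀ A ∈ 𝒮, ∀ i, IntegrableOn (fun s => α s i) A lam
  integral_eq : ∀ A ∈ 𝒮, ∀ i, ∫ s in A, α s i ∂lam = γ A i

/-- `β` is measurable, integrable over each `A ∈ 𝒮`, with integral `Q A` (component-wise). -/
structure IsMatrixDensity {S : Type*} [MeasurableSpace S] {m : ℕ} (𝒮 : Set (Set S))
    (lam : Measure S) (Q : Set S → Matrix (Fin m) (Fin m) ℝ)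
    (β : S → Matrix (Fin m) (Fin m) ℝ) : Prop where
  measurable : ∀ i j, Measurable (fun s => β s i j)
  integrableOn : ∀ A ∈ 𝒮, ∀ i j, IntegrableOn (fun s => β s i j) A lam
  integral_eq : ∀ A ∈ 𝒮, ∀ i j, ∫ s in A, β s i j ∂lam = Q A i j

/-- The function `K_M(t, s)`: the Lévy–Khintchine exponent of `[α(s), β(s), ρ(s, ·)]` at `t`. -/
def expKernel {S : Type*} [MeasurableSpace S] {m : ℕ} (α : S → EuclideanSpace ℝ (Fin m))
    (β : S → Matrix (Fin m) (Fin m) ℝ) (ρ : Kernel S (EuclideanSpace ℝ (Fin m)))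
    (t : EuclideanSpace ℝ (Fin m)) (s : S) : ℂ :=
  levyKhintchineExponent (α s) (β s) (ρ s) t

end ISRM

end

noncomputable section

namespace ISRM

variable {S : Type*} {𝒮 : Set (Set S)}

/-! The triplet of an infinitely divisible law is unique (`HasLevyTriplet.unique`): second
differences of the exponent are characteristic functions of finite measures, which reveal `Q` as a
mass at the origin and `φ` away from it. Since independence makes exponents add, `γ`, `Q` and `φ`
are finitely additive on `𝒮`.

They are even `σ`-additive (`IsISRM.triplet_remainder`). On the remainders of a disjoint union `M`
tends to `0` almost surely, so the characteristic functions tend to `1`. Their moduli force the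
Gaussian part and the integrals of `1 - cos⟨t, x⟩` to `0`, which makes `φ` `σ`-additive; once these
parts are stripped off, the shifts tend to `0` as well.

A measurable subset of a member of a `δ`-ring is again a member, so a `σ`-additive `[0, ∞]`-valued
set function that vanishes at `∅` extends to a measure on `σ(𝒮)`. This produces the control measure.
It dominates `γ`, the entries of `Q` and the truncated second moments, so Radon–Nikodym gives `α`
and `β`. The measures `min {1, ‖x‖²} φ_A(dx)` are finite and disintegrate like a regular conditional
distribution (`exists_kernel`); dividing by the weight gives `ρ`. The exponent is linear in the
triplet, so Fubini (`integral_expKernel`) identifies the integral of `K_M` over `A` with the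
exponent of `M(A)`. -/

/-- `σ`-additivity of a set function on a class of sets. -/
def IsSigmaAdditive {V : Type*} [AddCommMonoid V] [TopologicalSpace V] (𝒮 : Set (Set S))
    (T : Set S → V) : Prop :=
  ∀ A : ℕ → Set S, (∀ n, A n ∈ 𝒮) → Pairwise (fun i j => Disjoint (A i) (A j)) →
    (⋃ n, A n) ∈ 𝒮 → HasSum (fun n => T (A n)) (T (⋃ n, A n))

/-! ### Set algebra and measures on a `δ`-ring. -/

namespace IsDeltaRing

/-- De Morgan inside `A`: without the bound `A`, countable unions may leave `𝒮`. -/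
lemma iUnion_mem_of_subset (h : IsDeltaRing 𝒮) {A : Set S} (hA : A ∈ 𝒮) {B : ℕ → Set S}
    (hB : ∀ n, B n ∈ 𝒮) (hBA : ∀ n, B n ⊆ A) : (⋃ n, B n) ∈ 𝒮 := by
  have h1 : (⋃ n, B n) = A \ ⋂ n, (A \ B n) := by
    rw [Set.sdiff_iInter]
    refine Set.iUnion_congr fun n => ?_
    rw [Set.sdiff_sdiff_right_self, Set.inter_eq_self_of_subset_right (hBA n)]
  rw [h1]
  exact h.isSetRing.sdiff_mem hA (h.iInter_mem _ fun n => h.isSetRing.sdiff_mem hA (hB n))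

lemma exists_disjoint_cover (h : IsDeltaRing 𝒮) :
    ∃ E : ℕ → Set S, (∀ n, E n ∈ 𝒮) ∧ Pairwise (fun i j => Disjoint (E i) (E j)) ∧
      (⋃ n, E n) = Set.univ := by
  obtain ⟨A, hA, hU⟩ := h.exists_cover
  refine ⟨disjointed A, fun n => ?_, disjoint_disjointed A, by rw [iUnion_disjointed, hU]⟩
  exact h.isSetRing.disjointed_mem hA n

variable [mS : MeasurableSpace S]

lemma measurableSet (hσ : mS = MeasurableSpace.generateFrom 𝒮) {A : Set S} (hA : A ∈ 𝒮) :
    MeasurableSet A := by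
  rw [hσ]; exact MeasurableSpace.measurableSet_generateFrom hA

/-- The localization principle behind every passage from `𝒮` to `σ(𝒮)`. Inside a fixed `A`,
complements become differences and countable unions stay bounded by `A`, so induction over the
generated `σ`-algebra never leaves `𝒮`. -/
lemma inter_measurableSet_mem (h : IsDeltaRing 𝒮) (hσ : mS = MeasurableSpace.generateFrom 𝒮)
    {X A : Set S} (hX : MeasurableSet X) (hA : A ∈ 𝒮) : X ∩ A ∈ 𝒮 := by
  rw [hσ] at hX
  induction X, hX using MeasurableSpace.generateFrom_induction with
  | hC t ht _ => exact h.isSetRing.inter_mem ht hA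
  | empty => rw [Set.empty_inter]; exact h.isSetRing.empty_mem
  | compl t _ ih =>
    have : tᶜ ∩ A = A \ (t ∩ A) := by ext x; simp; tauto
    rw [this]; exact h.isSetRing.sdiff_mem hA ih
  | iUnion s _ ih =>
    rw [Set.iUnion_inter]
    exact h.iUnion_mem_of_subset hA ih fun n => Set.inter_subset_right

/-- Two measures that agree on a `δ`-ring and are finite there agree. -/
lemma measure_ext (h : IsDeltaRing 𝒮) (hσ : mS = MeasurableSpace.generateFrom 𝒮)
    {μ ν : Measure S} (hfin : ∀ A ∈ 𝒮, μ A ≠ ∞) (heq : ∀ A ∈ 𝒮, μ A = ν A) : μ = ν := by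
  obtain ⟨E, hE, hU⟩ := h.exists_cover
  exact Measure.ext_of_generateFrom_of_iUnion 𝒮 E hσ
    (fun s hs t ht _ => h.isSetRing.inter_mem hs ht) hU hE (fun i => hfin _ (hE i)) heq

lemma measure_le (h : IsDeltaRing 𝒮) (hσ : mS = MeasurableSpace.generateFrom 𝒮)
    {μ ν : Measure S} (hle : ∀ A ∈ 𝒮, μ A ≤ ν A) : μ ≤ ν := by
  obtain ⟨E, hE, hd, hU⟩ := h.exists_disjoint_cover
  have key : ∀ (κ : Measure S) (X : Set S), MeasurableSet X → κ X = ∑' n, κ (X ∩ E n) := by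
    intro κ X hX
    rw [← measure_iUnion, ← Set.inter_iUnion, hU, Set.inter_univ]
    · exact fun i j hij => (hd hij).mono Set.inter_subset_right Set.inter_subset_right
    · exact fun n => hX.inter (measurableSet hσ (hE n))
  refine Measure.le_intro fun X hX _ => ?_
  rw [key μ X hX, key ν X hX]
  exact ENNReal.tsum_le_tsum fun n => hle _ (h.inter_measurableSet_mem hσ hX (hE n))

lemma sigmaFinite (h : IsDeltaRing 𝒮)
    {μ : Measure S} (hfin : ∀ A ∈ 𝒮, μ A ≠ ∞) : SigmaFinite μ := by
  obtain ⟨E, hE, hU⟩ := h.exists_cover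
  exact ⟨⟨⟨E, fun _ => trivial, fun n => (hfin _ (hE n)).lt_top, hU⟩⟩⟩

/-- A property that holds almost everywhere on the sets of a `δ`-ring holds almost everywhere. -/
lemma ae_of_forall_restrict (h : IsDeltaRing 𝒮) {μ : Measure S} {p : S → Prop}
    (hp : ∀ A ∈ 𝒮, ∀ᵐ s ∂μ.restrict A, p s) : ∀ᵐ s ∂μ, p s := by
  obtain ⟨E, hE, hU⟩ := h.exists_cover
  rw [← Measure.restrict_univ (μ := μ), ← hU, ae_restrict_iUnion_iff]
  exact fun n => hp _ (hE n)

end IsDeltaRing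

/-! ### Extension of set functions to measures, and densities. -/

/-- Countable additivity of the candidate extension `X ↦ ∑ Λ (X ∩ E n)`; nonnegative sums commute.
-/
lemma IsSigmaAdditive.tsum_inter {Λ : Set S → ℝ≥0∞} [mS : MeasurableSpace S]
    (h : IsDeltaRing 𝒮) (hσ : mS = MeasurableSpace.generateFrom 𝒮)
    (hΛ : IsSigmaAdditive 𝒮 Λ) {E : ℕ → Set S} (hE : ∀ n, E n ∈ 𝒮)
    {X : ℕ → Set S}
    (hX : ∀ n, MeasurableSet (X n)) (hXd : Pairwise (fun i j => Disjoint (X i) (X j))) :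
    ∑' n, Λ ((⋃ k, X k) ∩ E n) = ∑' k, ∑' n, Λ (X k ∩ E n) := by
  rw [ENNReal.tsum_comm]
  refine tsum_congr fun n => ?_
  rw [Set.iUnion_inter]
  refine (hΛ (fun k => X k ∩ E n) (fun k => h.inter_measurableSet_mem hσ (hX k) (hE n)) ?_ ?_
    ).tsum_eq.symm
  · exact fun i j hij => (hXd hij).mono Set.inter_subset_left Set.inter_subset_left
  · rw [← Set.iUnion_inter]
    exact h.inter_measurableSet_mem hσ (.iUnion hX) (hE n)

lemma IsSigmaAdditive.tsum_inter_eq {V : Type*} [AddCommMonoid V] [TopologicalSpace V]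
    [T2Space V] {T : Set S → V} (h : IsDeltaRing 𝒮) (hT : IsSigmaAdditive 𝒮 T)
    {E : ℕ → Set S} (hE : ∀ n, E n ∈ 𝒮) (hd : Pairwise (fun i j => Disjoint (E i) (E j)))
    (hU : (⋃ n, E n) = Set.univ) {A : Set S} (hA : A ∈ 𝒮) : ∑' n, T (A ∩ E n) = T A := by
  have h1 := hT (fun n => A ∩ E n) (fun n => h.isSetRing.inter_mem hA (hE n))
    (fun i j hij => (hd hij).mono Set.inter_subset_right Set.inter_subset_right)
  rw [← Set.inter_iUnion, hU, Set.inter_univ] at h1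
  exact (h1 hA).tsum_eq

/-- A `σ`-additive set function on a `δ`-ring extends to a measure. -/
lemma IsSigmaAdditive.exists_measure {Λ : Set S → ℝ≥0∞} [mS : MeasurableSpace S]
    (h : IsDeltaRing 𝒮) (hσ : mS = MeasurableSpace.generateFrom 𝒮)
    (h0 : Λ ∅ = 0) (hΛ : IsSigmaAdditive 𝒮 Λ) : ∃ μ : Measure S, ∀ A ∈ 𝒮, μ A = Λ A := by
  obtain ⟨E, hE, hd, hU⟩ := h.exists_disjoint_cover
  refine ⟨Measure.ofMeasurable (fun X _ => ∑' n, Λ (X ∩ E n)) (by simp [h0])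
    fun X hX hXd => hΛ.tsum_inter h hσ hE hX hXd, fun A hA => ?_⟩
  rw [Measure.ofMeasurable_apply _ (IsDeltaRing.measurableSet hσ hA)]
  exact hΛ.tsum_inter_eq h hE hd hU hA

/-- A summable constant sequence is zero. This fails in `[0, ∞]`, where the constant `∞` is
`σ`-additive; hence the separate hypothesis `h0` in `exists_measure`. -/
lemma IsSigmaAdditive.map_empty {V : Type*} [NormedAddCommGroup V] {T : Set S → V}
    (h : IsDeltaRing 𝒮) (hT : IsSigmaAdditive 𝒮 T) : T ∅ = 0 := by
  have h1 := hT (fun _ => ∅) (fun _ => h.isSetRing.empty_mem) (fun _ _ _ => by simp)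
    (by simpa using h.isSetRing.empty_mem)
  have h2 : Tendsto (fun _ : ℕ => T ∅) atTop (𝓝 0) := h1.summable.tendsto_atTop_zero
  exact tendsto_nhds_unique tendsto_const_nhds h2

/-- A `σ`-additive real set function on a `δ`-ring that is dominated by a measure has a density. -/
lemma IsSigmaAdditive.exists_density {T : Set S → ℝ} [mS : MeasurableSpace S]
    (h : IsDeltaRing 𝒮) (hσ : mS = MeasurableSpace.generateFrom 𝒮)
    (hT : IsSigmaAdditive 𝒮 T) {μ : Measure S} (hfin : ∀ A ∈ 𝒮, μ A ≠ ∞)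
    (hle : ∀ A ∈ 𝒮, |T A| ≤ μ.real A) :
    ∃ f : S → ℝ, Measurable f ∧ ∀ A ∈ 𝒮, IntegrableOn f A μ ∧ ∫ s in A, f s ∂μ = T A := by
  have := h.sigmaFinite hfin
  -- Adding `μ` makes `T` nonnegative, so the sum extends to a measure `ν ≤ 2μ`. The density of `T`
  -- is then that of `ν` minus `1`.
  have hadd : IsSigmaAdditive 𝒮 (fun A => ENNReal.ofReal (μ.real A + T A)) := by
    intro A hA hd hU
    have h1 : HasSum (fun n => μ.real (A n)) (μ.real (⋃ n, A n)) := by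
      have h2 := measure_iUnion (μ := μ) hd fun n => IsDeltaRing.measurableSet hσ (hA n)
      rw [measureReal_def, h2, ENNReal.tsum_toReal_eq fun n => hfin _ (hA n)]
      exact ENNReal.hasSum_toReal (by rw [← h2]; exact hfin _ hU)
    have h2 := h1.add (hT A hA hd hU)
    beta_reduce
    rw [← h2.tsum_eq, ENNReal.ofReal_tsum_of_nonneg _ h2.summable]
    · exact ENNReal.summable.hasSum
    · exact fun n => by linarith [neg_abs_le (T (A n)), hle _ (hA n)]
  obtain ⟨ν, hν⟩ := hadd.exists_measure h hσ (by simp [hT.map_empty h])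
  have hνle : ν ≤ (2 : ℝ≥0∞) • μ := by
    refine h.measure_le hσ fun A hA => ?_
    rw [hν A hA, Measure.smul_apply, smul_eq_mul, two_mul, ← ofReal_measureReal (hfin A hA),
      ← ENNReal.ofReal_add measureReal_nonneg measureReal_nonneg]
    exact ENNReal.ofReal_le_ofReal (by linarith [le_abs_self (T A), hle A hA])
  have hac : ν ≪ μ := (Measure.absolutelyContinuous_of_le hνle).trans
    (Measure.smul_absolutelyContinuous)
  have hνfin : ∀ A ∈ 𝒮, ν A ≠ ∞ := fun A hA => by rw [hν A hA]; exact ENNReal.ofReal_ne_top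
  have := h.sigmaFinite hνfin
  refine ⟨fun s => (ν.rnDeriv μ s).toReal - 1,
    (Measure.measurable_rnDeriv ν μ).ennreal_toReal.sub_const 1, fun A hA => ?_⟩
  have hi : IntegrableOn (fun s => (ν.rnDeriv μ s).toReal) A μ :=
    Measure.integrableOn_toReal_rnDeriv (hνfin A hA)
  have hc : IntegrableOn (fun _ => (1 : ℝ)) A μ := integrableOn_const (hfin A hA)
  refine ⟨hi.sub hc, ?_⟩
  rw [integral_sub hi hc, Measure.setIntegral_toReal_rnDeriv hac, setIntegral_const, measureReal_def,
    hν A hA, ENNReal.toReal_ofReal]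
  · simp
  · linarith [neg_abs_le (T A), hle A hA]

/-! ### Total variation of a set function. -/

section totalVariation

variable {S V : Type*} {𝒮 : Set (Set S)} [NormedAddCommGroup V] {T : Set S → V}

lemma sum_le_totalVariation {ι : Type*} [Fintype ι] {A : Set S} (B : ι → Set S)
    (hB : ∀ j, B j ∈ 𝒮 ∧ B j ⊆ A) (hd : Pairwise (fun i j => Disjoint (B i) (B j))) :
    ∑ j, ‖T (B j)‖ₑ ≤ totalVariation 𝒮 T A := by
  let e := Fintype.equivFin ι
  rw [← e.symm.sum_comp]
  unfold totalVariation
  refine le_iSup_of_le _ (le_iSup_of_le (B ∘ e.symm) (le_iSup₂_of_le (fun j => hB _) ?_ le_rfl))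
  exact fun i j hij => hd (e.symm.injective.ne hij)

lemma enorm_le_totalVariation {A : Set S} (hA : A ∈ 𝒮) : ‖T A‖ₑ ≤ totalVariation 𝒮 T A := by
  simpa using sum_le_totalVariation (T := T) (𝒮 := 𝒮) (fun _ : Unit => A)
    (fun _ => ⟨hA, subset_rfl⟩) (fun i j hij => (hij rfl).elim)

lemma totalVariation_le {A : Set S} {c : ℝ≥0∞}
    (hc : ∀ (n : ℕ) (B : Fin n → Set S), (∀ j, B j ∈ 𝒮 ∧ B j ⊆ A) →
      Pairwise (fun i j => Disjoint (B i) (B j)) → ∑ j, ‖T (B j)‖ₑ ≤ c) :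
    totalVariation 𝒮 T A ≤ c :=
  iSup_le fun n => iSup_le fun B => iSup₂_le fun h hd => hc n B h hd

lemma totalVariation_mono {A B : Set S} (hAB : A ⊆ B) :
    totalVariation 𝒮 T A ≤ totalVariation 𝒮 T B :=
  totalVariation_le fun _ C hC hd => sum_le_totalVariation C (fun j => ⟨(hC j).1,
    (hC j).2.trans hAB⟩) hd

lemma totalVariation_empty (h0 : T ∅ = 0) : totalVariation 𝒮 T ∅ = 0 := by
  refine le_antisymm (totalVariation_le fun n B hB _ => ?_) zero_le
  simp [fun j => Set.subset_empty_iff.1 (hB j).2, h0]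

/-- The nested suprema run over proofs and can have an empty index. A single supremum over a
nonempty type is what `ENNReal.iSup_add_iSup_le` needs. -/
lemma totalVariation_eq_iSup (A : Set S) : totalVariation 𝒮 T A =
    ⨆ p : {p : Σ n : ℕ, Fin n → Set S // (∀ j, p.2 j ∈ 𝒮 ∧ p.2 j ⊆ A) ∧
      Pairwise (fun i j => Disjoint (p.2 i) (p.2 j))}, ∑ j, ‖T (p.1.2 j)‖ₑ :=
  le_antisymm (totalVariation_le fun n B hB hd =>
      le_iSup_of_le ⟨⟨n, B⟩, hB, hd⟩ le_rfl)
    (iSup_le fun p => sum_le_totalVariation _ p.2.1 p.2.2)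

lemma totalVariation_add_le {A B : Set S} (hAB : Disjoint A B) :
    totalVariation 𝒮 T A + totalVariation 𝒮 T B ≤ totalVariation 𝒮 T (A ∪ B) := by
  have hne : ∀ C : Set S, Nonempty {p : Σ n : ℕ, Fin n → Set S //
      (∀ j, p.2 j ∈ 𝒮 ∧ p.2 j ⊆ C) ∧ Pairwise (fun i j => Disjoint (p.2 i) (p.2 j))} :=
    fun C => ⟨⟨⟨0, fun j => j.elim0⟩, fun j => j.elim0, fun j => j.elim0⟩⟩
  have := hne A
  have := hne B
  rw [totalVariation_eq_iSup A, totalVariation_eq_iSup B]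
  refine ENNReal.iSup_add_iSup_le fun p q => ?_
  have h1 := sum_le_totalVariation (T := T) (𝒮 := 𝒮) (A := A ∪ B)
    (Sum.elim p.1.2 q.1.2) ?_ ?_
  · simpa using h1
  · rintro (j | j)
    · exact ⟨(p.2.1 j).1, (p.2.1 j).2.trans Set.subset_union_left⟩
    · exact ⟨(q.2.1 j).1, (q.2.1 j).2.trans Set.subset_union_right⟩
  · rintro (i | i) (j | j) hij
    · exact p.2.2 (by simpa using hij)
    · exact hAB.mono (p.2.1 i).2 (q.2.1 j).2
    · exact hAB.symm.mono (q.2.1 i).2 (p.2.1 j).2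
    · exact q.2.2 (by simpa using hij)

/-- The total variation of a `σ`-additive set function is `σ`-additive. -/
lemma IsSigmaAdditive.isSigmaAdditive_totalVariation (h : IsDeltaRing 𝒮) (hT : IsSigmaAdditive 𝒮 T) :
    IsSigmaAdditive 𝒮 (totalVariation 𝒮 T) := by
  intro A hA hd hU
  rw [ENNReal.summable.hasSum_iff]
  refine le_antisymm ?_ (totalVariation_le fun n B hB hBd => ?_)
  -- Superadditivity and monotonicity bound every partial sum.
  · refine ENNReal.tsum_le_of_sum_range_le fun N => ?_
    have key : ∑ n ∈ Finset.range N, totalVariation 𝒮 T (A n) ≤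
        totalVariation 𝒮 T (⋃ n ∈ Finset.range N, A n) := by
      induction N with
      | zero => simp
      | succ N ih =>
        rw [Finset.sum_range_succ, Finset.range_add_one, Finset.set_biUnion_insert, Set.union_comm]
        refine (add_le_add_left ih _).trans (totalVariation_add_le ?_)
        simp only [Set.disjoint_iUnion_left, Finset.mem_range]
        exact fun i hi => hd hi.ne
    refine key.trans (totalVariation_mono ?_)
    exact Set.iUnion₂_subset fun n _ => Set.subset_iUnion A n
  -- Conversely, cutting each `B j` along the `A k` only increases the sum of norms, and the pieces
  -- inside `A k` compete in its variation.
  · have h1 : ∀ j, ‖T (B j)‖ₑ ≤ ∑' k, ‖T (B j ∩ A k)‖ₑ := fun j => by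
      have hBU : (⋃ k, B j ∩ A k) = B j := by
        rw [← Set.inter_iUnion, Set.inter_eq_left]; exact (hB j).2
      have h2 := hT (fun k => B j ∩ A k) (fun k => h.isSetRing.inter_mem (hB j).1 (hA k))
        (fun i k hik => (hd hik).mono Set.inter_subset_right Set.inter_subset_right)
        (by rw [hBU]; exact (hB j).1)
      rw [hBU] at h2
      rw [← h2.tsum_eq]
      exact enorm_tsum_le_tsum_enorm
    calc ∑ j, ‖T (B j)‖ₑ ≤ ∑ j, ∑' k, ‖T (B j ∩ A k)‖ₑ := Finset.sum_le_sum fun j _ => h1 j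
      _ = ∑' k, ∑ j, ‖T (B j ∩ A k)‖ₑ :=
        (Summable.tsum_finsetSum fun _ _ => ENNReal.summable).symm
      _ ≤ ∑' k, totalVariation 𝒮 T (A k) := ENNReal.tsum_le_tsum fun k =>
        sum_le_totalVariation _ (fun j => ⟨h.isSetRing.inter_mem (hB j).1 (hA k),
          Set.inter_subset_right⟩)
          (fun i j hij => (hBd hij).mono Set.inter_subset_left Set.inter_subset_left)

/-- A real `σ`-additive set function on a `δ`-ring has finite total variation. -/
lemma IsSigmaAdditive.totalVariation_lt_top [mS : MeasurableSpace S] (h : IsDeltaRing 𝒮)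
    (hσ : mS = MeasurableSpace.generateFrom 𝒮) {T : Set S → ℝ} (hT : IsSigmaAdditive 𝒮 T)
    {A : Set S} (hA : A ∈ 𝒮) : totalVariation 𝒮 T A < ∞ := by
  classical
  -- Localized to `A`, the set function is a signed measure on `σ(𝒮)`, and these have finite
  -- variation.
  let v : SignedMeasure S :=
    { measureOf' := fun X => if MeasurableSet X then T (X ∩ A) else 0
      empty' := by simp [hT.map_empty h]
      not_measurable' := fun X hX => by simp [hX]
      m_iUnion' := fun X hX hXd => by
        simp only [hX, MeasurableSet.iUnion hX, if_true]
        rw [Set.iUnion_inter]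
        refine hT (fun n => X n ∩ A) (fun n => h.inter_measurableSet_mem hσ (hX n) hA)
          (fun i j hij => (hXd hij).mono Set.inter_subset_left Set.inter_subset_left) ?_
        rw [← Set.iUnion_inter]
        exact h.inter_measurableSet_mem hσ (.iUnion hX) hA }
  have hv : ∀ B ∈ 𝒮, B ⊆ A → T B = v B := fun B hB hBA => by
    change _ = if MeasurableSet B then T (B ∩ A) else 0
    rw [if_pos (IsDeltaRing.measurableSet hσ hB), Set.inter_eq_self_of_subset_left hBA]
  refine lt_of_le_of_lt (totalVariation_le (c := v.totalVariation Set.univ) fun n B hB hd => ?_)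
    (measure_lt_top _ _)
  calc ∑ j, ‖T (B j)‖ₑ ≤ ∑ j, v.totalVariation (B j) := Finset.sum_le_sum fun j _ => by
        rw [hv _ (hB j).1 (hB j).2]
        exact v.enorm_le_totalVariation _
    _ = v.totalVariation (⋃ j, B j) := by
        rw [measure_iUnion hd (fun j => IsDeltaRing.measurableSet hσ (hB j).1), tsum_fintype]
    _ ≤ _ := measure_mono (Set.subset_univ _)

/-- Reduces finiteness of the variation to real components, where signed measures are available. -/
lemma totalVariation_euclidean_le {m : ℕ} {T : Set S → EuclideanSpace ℝ (Fin m)} (A : Set S) :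
    totalVariation 𝒮 T A ≤ ∑ i, totalVariation 𝒮 (fun B => T B i) A := by
  refine totalVariation_le fun n B hB hd => ?_
  have h1 : ∀ x : EuclideanSpace ℝ (Fin m), ‖x‖ₑ ≤ ∑ i, ‖x i‖ₑ := fun x => by
    conv_lhs => rw [← (EuclideanSpace.basisFun (Fin m) ℝ).sum_repr x]
    refine (enorm_sum_le _ _).trans (Finset.sum_le_sum fun i _ => ?_)
    simp [enorm_smul, ← ofReal_norm (EuclideanSpace.single i (1 : ℝ))]
  calc ∑ j, ‖T (B j)‖ₑ ≤ ∑ j, ∑ i, ‖T (B j) i‖ₑ := Finset.sum_le_sum fun j _ => h1 _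
    _ = ∑ i, ∑ j, ‖T (B j) i‖ₑ := Finset.sum_comm
    _ ≤ _ := Finset.sum_le_sum fun i _ => sum_le_totalVariation (T := fun B => T B i) B hB hd

end totalVariation

/-! ### Disintegration of families of measures. -/

section disintegration

variable {S : Type*} [mS : MeasurableSpace S]

/-- A family of measures on `ℝ` that is `σ`-additive in its index set disintegrates. -/
lemma exists_kernel_real (N : Set S → Measure ℝ) (μ : Measure S) [SigmaFinite μ]
    (h0 : ∀ B, MeasurableSet B → N ∅ B = 0)
    (hadd : ∀ B, MeasurableSet B → ∀ X : ℕ → Set S, (∀ n, MeasurableSet (X n)) →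
      Pairwise (fun i j => Disjoint (X i) (X j)) → N (⋃ n, X n) B = ∑' n, N (X n) B)
    (hμ : ∀ X, MeasurableSet X → μ X = N X Set.univ) :
    ∃ κ : Kernel S ℝ, IsMarkovKernel κ ∧ ∀ X, MeasurableSet X → ∀ B, MeasurableSet B →
      ∫⁻ s in X, κ s B ∂μ = N X B := by
  -- Each fixed `B` has a Radon–Nikodym density `f B`. The rest of the proof glues the `f B` into
  -- one kernel through the distribution function at rational points.
  have hex : ∀ B, MeasurableSet B → ∃ f : S → ℝ≥0∞, Measurable f ∧
      ∀ X, MeasurableSet X → ∫⁻ s in X, f s ∂μ = N X B := by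
    intro B hB
    let ν : Measure S := Measure.ofMeasurable (fun X _ => N X B) (h0 B hB)
      fun X hX hd => hadd B hB X hX hd
    have hν : ∀ X, MeasurableSet X → ν X = N X B := fun X hX => Measure.ofMeasurable_apply X hX
    have hle : ν ≤ μ := Measure.le_intro fun X hX _ => by
      rw [hν X hX, hμ X hX]; exact measure_mono (Set.subset_univ _)
    have : SFinite ν := sFinite_of_absolutelyContinuous (Measure.absolutelyContinuous_of_le hle)
    refine ⟨ν.rnDeriv μ, Measure.measurable_rnDeriv _ _, fun X hX => ?_⟩
    rw [Measure.setLIntegral_rnDeriv (Measure.absolutelyContinuous_of_le hle), hν X hX]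
  choose! f hf hfN using hex
  have hmono : ∀ B C, MeasurableSet B → MeasurableSet C → B ⊆ C → ∀ᵐ s ∂μ, f B s ≤ f C s := by
    intro B C hB hC hBC
    refine ae_le_of_forall_setLIntegral_le_of_sigmaFinite (hf B hB) fun X hX _ => ?_
    rw [hfN B hB X hX, hfN C hC X hX]
    exact measure_mono hBC
  have hone : ∀ B, MeasurableSet B → ∀ᵐ s ∂μ, f B s + f Bᶜ s = 1 := by
    intro B hB
    refine ae_eq_of_forall_setLIntegral_eq_of_sigmaFinite ((hf B hB).add (hf _ hB.compl))
      measurable_const fun X hX _ => ?_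
    rw [lintegral_add_left (hf B hB), hfN B hB X hX, hfN _ hB.compl X hX, measure_add_measure_compl hB,
      ← hμ X hX]
    simp
  have huniv : ∀ᵐ s ∂μ, f Set.univ s = 1 := by
    refine ae_eq_of_forall_setLIntegral_eq_of_sigmaFinite (hf _ .univ)
      measurable_const fun X hX _ => ?_
    rw [hfN _ .univ X hX, ← hμ X hX]
    simp
  -- Continuity from below only. Right continuity and the limit at `-∞` will come from the
  -- complementary rays `Ioi q`, whose density is `1 - F s q`.
  have hsup : ∀ B : ℕ → Set ℝ, (∀ n, MeasurableSet (B n)) → Monotone B →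
      ∀ᵐ s ∂μ, ⨆ n, f (B n) s = f (⋃ n, B n) s := by
    intro B hB hBm
    refine ae_eq_of_forall_setLIntegral_eq_of_sigmaFinite (.iSup fun n => hf _ (hB n))
      (hf _ (.iUnion hB)) fun X hX _ => ?_
    rw [lintegral_iSup' (fun n => (hf _ (hB n)).aemeasurable), hfN _ (.iUnion hB) X hX,
      hBm.measure_iUnion]
    · exact iSup_congr fun n => hfN _ (hB n) X hX
    · refine ae_restrict_of_ae ?_
      have : ∀ᵐ s ∂μ, ∀ n, f (B n) s ≤ f (B (n + 1)) s :=
        ae_all_iff.2 fun n => hmono _ _ (hB n) (hB _) (hBm n.le_succ)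
      filter_upwards [this] with s hs using monotone_nat_of_le_succ hs
  let F : S → ℚ → ℝ := fun s q => (f (Set.Iic (q : ℝ)) s).toReal
  have hF : Measurable F := measurable_pi_lambda _ fun q => (hf _ measurableSet_Iic).ennreal_toReal
  have hle1 : ∀ᵐ s ∂μ, ∀ q : ℚ, f (Set.Iic (q : ℝ)) s ≤ 1 := ae_all_iff.2 fun q => by
    filter_upwards [hone (Set.Iic (q : ℝ)) measurableSet_Iic] with s hs
    rw [← hs]; exact le_self_add
  have hpt : ∀ᵐ s ∂μ, IsRatStieltjesPoint F s := by
    have e1 : ∀ᵐ s ∂μ, ∀ q r : ℚ, q ≤ r → f (Set.Iic (q : ℝ)) s ≤ f (Set.Iic (r : ℝ)) s := by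
      refine ae_all_iff.2 fun q => ae_all_iff.2 fun r => ?_
      by_cases hqr : q ≤ r
      · filter_upwards [hmono (Set.Iic (q : ℝ)) (Set.Iic (r : ℝ)) measurableSet_Iic
          measurableSet_Iic (Set.Iic_subset_Iic.2 (by exact_mod_cast hqr))] with s hs _ using hs
      · exact ae_of_all _ fun s hs => absurd hs hqr
    have e2 : ∀ᵐ s ∂μ, ∀ q : ℚ, f (Set.Iic (q : ℝ)) s + f (Set.Ioi (q : ℝ)) s = 1 :=
      ae_all_iff.2 fun q => by simpa using hone (Set.Iic (q : ℝ)) measurableSet_Iic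
    have e3 : ∀ᵐ s ∂μ, ⨆ n : ℕ, f (Set.Iic (((n : ℚ) : ℝ))) s = 1 := by
      filter_upwards [hsup (fun n : ℕ => Set.Iic (((n : ℚ) : ℝ))) (fun n => measurableSet_Iic)
        (fun a b hab => Set.Iic_subset_Iic.2 (by exact_mod_cast hab)), huniv] with s hs hs'
      rw [hs, ← hs']
      congr
      refine Set.eq_univ_of_forall fun x => ?_
      obtain ⟨n, hn⟩ := exists_nat_ge x
      exact Set.mem_iUnion.2 ⟨n, by simpa using hn⟩
    have e4 : ∀ᵐ s ∂μ, ⨆ n : ℕ, f (Set.Ioi (((-n : ℚ) : ℝ))) s = 1 := by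
      filter_upwards [hsup (fun n : ℕ => Set.Ioi (((-n : ℚ) : ℝ))) (fun n => measurableSet_Ioi)
        (fun a b hab => Set.Ioi_subset_Ioi (by push_cast; simpa using hab)), huniv] with s hs hs'
      rw [hs, ← hs']
      congr
      refine Set.eq_univ_of_forall fun x => ?_
      obtain ⟨n, hn⟩ := exists_nat_gt (-x)
      exact Set.mem_iUnion.2 ⟨n, by simp; linarith⟩
    have e5 : ∀ᵐ s ∂μ, ∀ q : ℚ, ⨆ n : ℕ, f (Set.Ioi (((q + 1 / (n + 1) : ℚ) : ℝ))) s =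
        f (Set.Ioi (q : ℝ)) s := by
      refine ae_all_iff.2 fun q => ?_
      have hU : (⋃ n : ℕ, Set.Ioi (((q + 1 / (n + 1) : ℚ) : ℝ))) = Set.Ioi (q : ℝ) := by
        ext x
        simp only [Set.mem_iUnion, Set.mem_Ioi]
        push_cast
        constructor
        · rintro ⟨n, hn⟩
          have : (0 : ℝ) < 1 / (n + 1) := Nat.one_div_pos_of_nat
          linarith
        · intro hx
          obtain ⟨n, hn⟩ := exists_nat_one_div_lt (sub_pos.2 hx)
          exact ⟨n, by linarith⟩
      have := hsup (fun n : ℕ => Set.Ioi (((q + 1 / (n + 1) : ℚ) : ℝ))) (fun n => measurableSet_Ioi)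
        (fun a b hab => Set.Ioi_subset_Ioi (by
          push_cast
          have : (1 : ℝ) / (b + 1) ≤ 1 / (a + 1) := Nat.one_div_le_one_div hab
          linarith))
      rwa [hU] at this
    filter_upwards [hle1, e1, e2, e3, e4, e5] with s h1 hm h2 h3 h4 h5
    have hfin : ∀ q : ℚ, f (Set.Iic (q : ℝ)) s ≠ ∞ := fun q => ((h1 q).trans_lt ENNReal.one_lt_top).ne
    have hg : ∀ q : ℚ, (f (Set.Ioi (q : ℝ)) s).toReal = 1 - F s q := fun q => by
      have hq : f (Set.Ioi (q : ℝ)) s ≠ ∞ := by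
        refine ne_top_of_le_ne_top ENNReal.one_ne_top ?_
        rw [← h2 q]; exact le_add_self
      have := congrArg ENNReal.toReal (h2 q)
      rw [ENNReal.toReal_add (hfin q) hq] at this
      simp only [F]
      simp at this; linarith
    have hFm : Monotone (F s) := fun q r hqr => ENNReal.toReal_mono (hfin r) (hm q r hqr)
    have hF0 : ∀ q, 0 ≤ F s q := fun q => ENNReal.toReal_nonneg
    have hgm : ∀ q r : ℚ, q ≤ r → f (Set.Ioi (r : ℝ)) s ≤ f (Set.Ioi (q : ℝ)) s := fun q r hqr => by
      have a := h2 q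
      have b := h2 r
      have hr : f (Set.Ioi (r : ℝ)) s ≠ ∞ :=
        ne_top_of_le_ne_top ENNReal.one_ne_top (by rw [← b]; exact le_add_self)
      have hq : f (Set.Ioi (q : ℝ)) s ≠ ∞ :=
        ne_top_of_le_ne_top ENNReal.one_ne_top (by rw [← a]; exact le_add_self)
      rw [← ENNReal.toReal_le_toReal hr hq, hg, hg]
      linarith [hFm hqr]
    refine ⟨hFm, ?_, ?_, fun q => ?_⟩
    · have t1 : Tendsto (fun n : ℕ => F s (n : ℚ)) atTop (𝓝 1) := by
        have := tendsto_atTop_iSup (f := fun n : ℕ => f (Set.Iic (((n : ℚ) : ℝ))) s)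
          (fun a b hab => hm _ _ (by exact_mod_cast hab))
        rw [h3] at this
        exact (ENNReal.tendsto_toReal ENNReal.one_ne_top).comp this
      exact (tendsto_iff_tendsto_subseq_of_monotone hFm tendsto_natCast_atTop_atTop).2 t1
    · have t1 : Tendsto (fun n : ℕ => F s (-n : ℚ)) atTop (𝓝 0) := by
        have := tendsto_atTop_iSup (f := fun n : ℕ => f (Set.Ioi (((-n : ℚ) : ℝ))) s)
          (fun a b hab => hgm _ _ (by simpa using hab))
        rw [h4] at this
        have h6 := (ENNReal.tendsto_toReal ENNReal.one_ne_top).comp this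
        simp only [Function.comp_def, hg, ENNReal.toReal_one] at h6
        simpa using h6.const_sub 1
      have t2 : Tendsto (fun q : ℚ => F s (-q)) atTop (𝓝 0) :=
        (tendsto_iff_tendsto_subseq_of_antitone (fun a b hab => hFm (neg_le_neg hab))
          tendsto_natCast_atTop_atTop).2 t1
      simpa [Function.comp_def] using t2.comp tendsto_neg_atBot_atTop
    · refine le_antisymm ?_ (le_ciInf fun r => hFm (le_of_lt r.2))
      have t1 : Tendsto (fun n : ℕ => F s (q + 1 / (n + 1) : ℚ)) atTop (𝓝 (F s q)) := by
        have := tendsto_atTop_iSup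
          (f := fun n : ℕ => f (Set.Ioi (((q + 1 / (n + 1) : ℚ) : ℝ))) s) (fun a b hab =>
            hgm _ _ (by gcongr))
        rw [h5] at this
        have h6 := (ENNReal.tendsto_toReal (ne_top_of_le_ne_top ENNReal.one_ne_top
          (by rw [← h2 q]; exact le_add_self))).comp this
        simp only [Function.comp_def, hg] at h6
        simpa using h6.const_sub 1
      refine ge_of_tendsto t1 (Eventually.of_forall fun n => ?_)
      refine ciInf_le ⟨0, ?_⟩ (⟨q + 1 / (n + 1), ?_⟩ : Set.Ioi q)
      · rintro _ ⟨r, rfl⟩; exact hF0 _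
      · have : (0 : ℚ) < 1 / (n + 1) := Nat.one_div_pos_of_nat
        simpa using this
  have : ∀ q : ℚ, ∀ᵐ s ∂μ, (stieltjesOfMeasurableRat F hF s).measure (Set.Iic (q : ℝ)) =
      f (Set.Iic (q : ℝ)) s := by
    intro q
    filter_upwards [hpt, hle1] with s hs h1
    rw [measure_stieltjesOfMeasurableRat_Iic, stieltjesOfMeasurableRat_eq,
      toRatCDF_of_isRatStieltjesPoint hs,
      ENNReal.ofReal_toReal ((h1 q).trans_lt ENNReal.one_lt_top).ne]
  -- Off the good points `stieltjesOfMeasurableRat` uses a default distribution function, so `κ` is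
  -- Markov for every `s`.
  let κ : Kernel S ℝ := ⟨fun s => (stieltjesOfMeasurableRat F hF s).measure,
    measurable_measure_stieltjesOfMeasurableRat hF⟩
  have hκ : IsMarkovKernel κ := ⟨fun s => ⟨measure_stieltjesOfMeasurableRat_univ hF s⟩⟩
  refine ⟨κ, hκ, fun X hX B hB => ?_⟩
  rw [← hfN B hB X hX]
  refine setLIntegral_congr_fun_ae hX (Filter.Eventually.mono ?_ fun s hs _ => hs)
  -- Testing on `Y` of finite measure makes both sides finite measures in `B`, so agreement on the
  -- `π`-system of rational rays suffices.
  refine ae_eq_of_forall_setLIntegral_eq_of_sigmaFinite (κ.measurable_coe hB) (hf B hB)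
    fun Y hY hYfin => ?_
  rw [hfN B hB Y hY, ← Measure.bind_apply hB κ.measurable.aemeasurable]
  have hfin : IsFiniteMeasure ((μ.restrict Y).bind κ) := ⟨by
    rw [Measure.bind_apply .univ κ.measurable.aemeasurable]
    simpa using hYfin⟩
  refine congrArg (fun ν : Measure ℝ => ν B) (ext_of_generate_finite _
    ((BorelSpace.measurable_eq (α := ℝ)).trans Real.borel_eq_generateFrom_Iic_rat)
    Real.isPiSystem_Iic_rat (fun s hs => ?_) ?_)
  · obtain ⟨q, rfl⟩ : ∃ q : ℚ, Set.Iic (q : ℝ) = s := by simpa [eq_comm] using hs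
    rw [Measure.bind_apply measurableSet_Iic κ.measurable.aemeasurable,
      ← hfN _ measurableSet_Iic Y hY]
    exact lintegral_congr_ae (ae_restrict_of_ae (this q))
  · rw [Measure.bind_apply .univ κ.measurable.aemeasurable, ← hμ Y hY]
    simp

/-- A family of measures on a standard Borel space that is `σ`-additive in its index set
disintegrates. -/
lemma exists_kernel {E : Type*} [MeasurableSpace E] [StandardBorelSpace E] (N : Set S → Measure E)
    (μ : Measure S) [SigmaFinite μ] (h0 : ∀ B, MeasurableSet B → N ∅ B = 0)
    (hadd : ∀ B, MeasurableSet B → ∀ X : ℕ → Set S, (∀ n, MeasurableSet (X n)) →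
      Pairwise (fun i j => Disjoint (X i) (X j)) → N (⋃ n, X n) B = ∑' n, N (X n) B)
    (hμ : ∀ X, MeasurableSet X → μ X = N X Set.univ) :
    ∃ κ : Kernel S E, (∀ s, κ s Set.univ ≤ 1) ∧ ∀ X, MeasurableSet X → ∀ B, MeasurableSet B →
      ∫⁻ s in X, κ s B ∂μ = N X B := by
  have he := measurableEmbedding_embeddingReal E
  have hm : ∀ X (B : Set ℝ), MeasurableSet B →
      (N X).map (embeddingReal E) B = N X (embeddingReal E ⁻¹' B) :=
    fun X B hB => Measure.map_apply he.measurable hB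
  obtain ⟨κ, hκ, h⟩ := exists_kernel_real (fun X => (N X).map (embeddingReal E)) μ
    (fun B hB => by rw [hm _ _ hB]; exact h0 _ (he.measurable hB))
    (fun B hB X hX hd => by
      simp only [hm _ _ hB]; exact hadd _ (he.measurable hB) X hX hd)
    (fun X hX => by rw [hm _ _ .univ]; exact hμ X hX)
  -- Pulling back along the embedding into `ℝ` loses any mass outside its range; only total mass at
  -- most `1` survives for every `s`.
  refine ⟨κ.comapRight he, fun s => ?_, fun X hX B hB => ?_⟩
  · rw [Kernel.comapRight_apply, he.comap_apply]; exact prob_le_one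
  · simp only [Kernel.comapRight_apply, he.comap_apply]
    rw [h X hX _ (he.measurableSet_image.2 hB), hm _ _ (he.measurableSet_image.2 hB),
      Set.preimage_image_eq _ he.injective]

variable {𝒮 : Set (Set S)} {m : ℕ} {φ : Set S → Measure (EuclideanSpace ℝ (Fin m))}

lemma measurable_truncation : Measurable
    (fun x : EuclideanSpace ℝ (Fin m) => ENNReal.ofReal (min 1 (‖x‖ ^ 2))) := by
  fun_prop

lemma truncation_ne_zero {x : EuclideanSpace ℝ (Fin m)} (hx : x ≠ 0) :
    ENNReal.ofReal (min 1 (‖x‖ ^ 2)) ≠ 0 := by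
  have : 0 < ‖x‖ := norm_pos_iff.2 hx
  simp only [ne_eq, ENNReal.ofReal_eq_zero, not_le]
  positivity

/-- A `σ`-additive family of Lévy measures disintegrates with respect to every measure that
dominates the truncated second moments. -/
lemma exists_levyTransition (h : IsDeltaRing 𝒮) (hσ : mS = MeasurableSpace.generateFrom 𝒮)
    (hφ : ∀ A ∈ 𝒮, IsLevyMeasure (φ A)) (h0 : φ ∅ = 0)
    (hadd : ∀ B, MeasurableSet B → IsSigmaAdditive 𝒮 (fun A => φ A B))
    {lam : Measure S} (hfin : ∀ A ∈ 𝒮, lam A ≠ ∞)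
    (hlam : ∀ A ∈ 𝒮, truncatedSecondMoment (φ A) ≤ lam A) :
    ∃ ρ : Kernel S (EuclideanSpace ℝ (Fin m)), IsLevyTransition 𝒮 φ lam ρ ∧
      ∀ s, truncatedSecondMoment (ρ s) ≤ 1 := by
  have := h.sigmaFinite hfin
  obtain ⟨E, hE, hd, hU⟩ := h.exists_disjoint_cover
  set w : EuclideanSpace ℝ (Fin m) → ℝ≥0∞ := fun x => ENNReal.ofReal (min 1 (‖x‖ ^ 2)) with hw
  have hwm : Measurable w := measurable_truncation
  -- Weighting turns the possibly infinite Lévy measures into finite ones.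
  let φw : Set S → Measure (EuclideanSpace ℝ (Fin m)) := fun A => (φ A).withDensity w
  have hφsum : ∀ A : ℕ → Set S, (∀ n, A n ∈ 𝒮) → Pairwise (fun i j => Disjoint (A i) (A j)) →
      (⋃ n, A n) ∈ 𝒮 → φ (⋃ n, A n) = Measure.sum fun n => φ (A n) := by
    intro A hA hAd hAU
    ext B hB
    rw [Measure.sum_apply _ hB]
    exact ((hadd B hB) A hA hAd hAU).tsum_eq.symm
  have haddw : ∀ B, MeasurableSet B → IsSigmaAdditive 𝒮 (fun A => φw A B) := by
    intro B hB A hA hAd hAU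
    rw [ENNReal.summable.hasSum_iff]
    simp only [φw]
    rw [hφsum A hA hAd hAU, withDensity_sum, Measure.sum_apply _ hB]
  have hφw0 : φw ∅ = 0 := by simp [φw, h0]
  let N : Set S → Measure (EuclideanSpace ℝ (Fin m)) := fun X => .sum fun n => φw (X ∩ E n)
  have hN : ∀ X B, MeasurableSet B → N X B = ∑' n, φw (X ∩ E n) B :=
    fun X B hB => Measure.sum_apply _ hB
  have hN0 : N ∅ = 0 := by simp [N, hφw0]
  have hNadd : ∀ B, MeasurableSet B → ∀ X : ℕ → Set S, (∀ n, MeasurableSet (X n)) →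
      Pairwise (fun i j => Disjoint (X i) (X j)) → N (⋃ n, X n) B = ∑' n, N (X n) B := by
    intro B hB X hX hXd
    simp only [hN _ B hB]
    exact (haddw B hB).tsum_inter h hσ hE hX hXd
  have hNA : ∀ A ∈ 𝒮, N A = φw A := fun A hA => by
    ext B hB
    rw [hN A B hB]
    exact (haddw B hB).tsum_inter_eq h hE hd hU hA
  let ν : Measure S := Measure.ofMeasurable (fun X _ => N X Set.univ) (by simp [hN0])
    fun X hX hXd => hNadd _ .univ X hX hXd
  have hν : ∀ X, MeasurableSet X → ν X = N X Set.univ := fun X hX => Measure.ofMeasurable_apply X hX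
  have hνle : ν ≤ lam := h.measure_le hσ fun A hA => by
    rw [hν A (IsDeltaRing.measurableSet hσ hA), hNA A hA]
    simp only [φw]
    rw [withDensity_apply _ .univ, Measure.restrict_univ]
    exact hlam A hA
  have hac := Measure.absolutelyContinuous_of_le hνle
  have hνfin : ∀ A ∈ 𝒮, ν A ≠ ∞ := fun A hA => ne_top_of_le_ne_top (hfin A hA) (hνle A)
  have := h.sigmaFinite hνfin
  obtain ⟨κ, hκ1, hκ⟩ := exists_kernel N ν (by simp [hN0]) hNadd hν
  have : IsFiniteKernel κ := ⟨1, ENNReal.one_lt_top, hκ1⟩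
  -- The density is at most `1` only almost everywhere; the cut-off makes the moment bound hold for
  -- every `s`.
  let g : S → ℝ≥0∞ := fun s => min (ν.rnDeriv lam s) 1
  have hg : Measurable g := (Measure.measurable_rnDeriv _ _).min measurable_const
  have hgae : g =ᵐ[lam] ν.rnDeriv lam := by
    filter_upwards [Measure.rnDeriv_le_one_of_le hνle] with s hs
    exact min_eq_left hs
  have hνg : lam.withDensity g = ν := by
    rw [withDensity_congr_ae hgae, Measure.withDensity_rnDeriv_eq _ _ hac]
  -- The reciprocal weight, set to `0` at the origin where it would be `∞`; Lévy measures have no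
  -- mass there.
  let u : EuclideanSpace ℝ (Fin m) → ℝ≥0∞ := fun x => if x = 0 then 0 else (w x)⁻¹
  have hu : Measurable u := Measurable.ite (measurableSet_singleton 0) measurable_const hwm.inv
  have hgu : Measurable (Function.uncurry fun s x => g s * u x) :=
    (hg.comp measurable_fst).mul (hu.comp measurable_snd)
  let ρ : Kernel S (EuclideanSpace ℝ (Fin m)) := κ.withDensity fun s x => g s * u x
  have hρ : ∀ s B, ρ s B = g s * ∫⁻ x in B, u x ∂κ s := fun s B => by
    rw [Kernel.withDensity_apply' _ hgu, lintegral_const_mul _ hu]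
  have hwu : ∀ x, w x * u x ≤ 1 := fun x => by
    by_cases hx : x = 0
    · simp [u, hx]
    · simp only [u, if_neg hx]; exact ENNReal.mul_inv_le_one _
  -- On the `n`-th set `u ≤ n`, and `g` and the mass of `κ s` are at most `1`, hence the uniform
  -- bound `n`. For `n = 0` the set is `{0}`, where `u` vanishes.
  refine ⟨ρ, ⟨⟨fun n => {x | x = 0 ∨ 1 ≤ (n : ℝ) * min 1 (‖x‖ ^ 2)}, fun n => n, fun n => ?_, ?_,
    fun n s => ?_⟩, fun A hA B hB => ?_⟩, fun s => ?_⟩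
  · exact (measurableSet_singleton 0).union (measurableSet_le measurable_const (measurable_const.mul
      (measurable_const.min (measurable_norm.pow_const 2))))
  · refine Set.eq_univ_of_forall fun x => ?_
    by_cases hx : x = 0
    · exact Set.mem_iUnion.2 ⟨0, Or.inl hx⟩
    · have h1 : 0 < min 1 (‖x‖ ^ 2) := by
        have : 0 < ‖x‖ := norm_pos_iff.2 hx
        positivity
      obtain ⟨n, hn⟩ := exists_nat_ge (1 / min 1 (‖x‖ ^ 2))
      exact Set.mem_iUnion.2 ⟨n, Or.inr ((div_le_iff₀ h1).1 hn)⟩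
  · rw [hρ]
    have hle : ∀ x ∈ {x : EuclideanSpace ℝ (Fin m) | x = 0 ∨ 1 ≤ (n : ℝ) * min 1 (‖x‖ ^ 2)},
        u x ≤ n := by
      intro x hx
      by_cases hx0 : x = 0
      · simp [u, hx0]
      · simp only [u, if_neg hx0]
        rw [ENNReal.inv_le_iff_le_mul, mul_comm, ← ENNReal.ofReal_natCast, hw, ← ENNReal.ofReal_mul
          (by positivity)]
        · exact ENNReal.one_le_ofReal.2 (hx.resolve_left hx0)
        · exact fun _ => truncation_ne_zero hx0
        · exact fun hw' => absurd hw' ENNReal.ofReal_ne_top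
    calc g s * ∫⁻ x in {x | x = 0 ∨ 1 ≤ (n : ℝ) * min 1 (‖x‖ ^ 2)}, u x ∂κ s
        ≤ 1 * ∫⁻ x in {x | x = 0 ∨ 1 ≤ (n : ℝ) * min 1 (‖x‖ ^ 2)}, n ∂κ s := by
          exact mul_le_mul' (min_le_right _ _) (setLIntegral_mono measurable_const hle)
      _ ≤ n := by
          rw [one_mul, setLIntegral_const]
          calc (n : ℝ≥0∞) * κ s _ ≤ n * 1 := by
                gcongr; exact (measure_mono (Set.subset_univ _)).trans (hκ1 s)
            _ = n := mul_one _
      _ = _ := by simp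
  · have hAm := IsDeltaRing.measurableSet hσ hA
    have hbind : (ν.restrict A).bind κ = φw A := by
      ext C hC
      rw [Measure.bind_apply hC κ.measurable.aemeasurable, hκ A hAm C hC, hNA A hA]
    have hm : Measurable fun s => ∫⁻ x in B, u x ∂κ s := by
      simp only [← lintegral_indicator hB]
      exact (hu.indicator hB).lintegral_kernel
    simp only [hρ]
    have hmul := setLIntegral_withDensity_eq_setLIntegral_mul lam hg hm hAm
    simp only [Pi.mul_apply] at hmul
    rw [← hmul, hνg]
    simp only [← lintegral_indicator hB]
    rw [← Measure.lintegral_bind κ.measurable.aemeasurable (hu.indicator hB).aemeasurable, hbind,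
      lintegral_withDensity_eq_lintegral_mul _ hwm (hu.indicator hB), ← lintegral_indicator_one hB]
    refine lintegral_congr_ae ?_
    have h1 : ∀ᵐ x ∂φ A, x ≠ 0 := by simpa [ae_iff] using (hφ A hA).zero
    filter_upwards [h1] with x hx
    by_cases hxB : x ∈ B
    · simp only [Pi.mul_apply, Set.indicator_of_mem hxB, u, if_neg hx, Pi.one_apply]
      exact ENNReal.mul_inv_cancel (truncation_ne_zero hx) ENNReal.ofReal_ne_top
    · simp [Set.indicator_of_notMem hxB]
  · unfold truncatedSecondMoment
    rw [Kernel.lintegral_withDensity _ hgu _ hwm]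
    calc ∫⁻ x, g s * u x * w x ∂κ s ≤ ∫⁻ x, 1 ∂κ s := by
          refine lintegral_mono fun x => ?_
          rw [mul_assoc, mul_comm (u x)]
          exact mul_le_one' (min_le_right _ _) (hwu x)
      _ ≤ 1 := by simpa using hκ1 s

end disintegration

/-! ### The Lévy–Khintchine exponent and uniqueness of its triplet. -/

section LevyKhintchine

variable {m : ℕ}

/-! ### The integrand -/

lemma continuous_levyIntegrand_left (x : EuclideanSpace ℝ (Fin m)) : Continuous fun t : EuclideanSpace ℝ (Fin m) => levyIntegrand t x := by
  unfold levyIntegrand; fun_prop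

lemma continuous_levyIntegrand (t : EuclideanSpace ℝ (Fin m)) : Continuous (levyIntegrand t) := by
  unfold levyIntegrand
  refine Continuous.sub (by fun_prop) (Continuous.div (by fun_prop) (by fun_prop) fun x => ?_)
  have : (1 + ‖x‖ ^ 2 : ℝ) ≠ 0 := by positivity
  exact_mod_cast this

lemma norm_exp_I_mul_sub_le (a : ℝ) :
    ‖Complex.exp (Complex.I * (a : ℂ)) - 1 - Complex.I * (a : ℂ)‖ ≤ 2 * a ^ 2 := by
  by_cases ha : |a| ≤ 1
  · have h1 : ‖Complex.I * (a : ℂ)‖ = |a| := by simp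
    have := Complex.norm_exp_sub_one_sub_id_le (x := Complex.I * (a : ℂ)) (by rwa [h1])
    rw [h1, sq_abs] at this
    nlinarith [sq_nonneg a]
  · push Not at ha
    have h1 : ‖Complex.I * (a : ℂ)‖ = |a| := by simp
    have h2 : ‖Complex.exp (Complex.I * (a : ℂ)) - 1‖ ≤ ‖a‖ :=
      Real.norm_exp_I_mul_ofReal_sub_one_le
    calc _ ≤ ‖Complex.exp (Complex.I * (a : ℂ)) - 1‖ + ‖Complex.I * (a : ℂ)‖ := norm_sub_le _ _
      _ ≤ |a| + |a| := by rw [h1]; exact add_le_add_left h2 _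
      _ ≤ 2 * a ^ 2 := by rw [← sq_abs a]; nlinarith

/-- The constant in the estimate of the integrand. -/
def levyBound (r : ℝ) : ℝ := 2 + r + 2 * r ^ 2

lemma levyBound_mono {r s : ℝ} (hr : 0 ≤ r) (hrs : r ≤ s) : levyBound r ≤ levyBound s := by
  unfold levyBound; gcongr

/-- For `‖x‖ ≤ 1`, a second-order Taylor bound plus the compensator error `⟨t, x⟩‖x‖² / (1 + ‖x‖²)`.
For `‖x‖ ≥ 1` every term is bounded, since `‖x‖ ≤ 1 + ‖x‖²`. The constant in `levyBound` covers both
regimes. -/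
lemma norm_levyIntegrand_le (t x : EuclideanSpace ℝ (Fin m)) :
    ‖levyIntegrand t x‖ ≤ levyBound ‖t‖ * min 1 (‖x‖ ^ 2) := by
  set a : ℝ := inner ℝ t x with ha
  have hat : |a| ≤ ‖t‖ * ‖x‖ := abs_real_inner_le_norm t x
  have ht := norm_nonneg t
  have hx := norm_nonneg x
  have hpos : (0 : ℝ) < 1 + ‖x‖ ^ 2 := by positivity
  have hne : ((1 + ‖x‖ ^ 2 : ℝ) : ℂ) ≠ 0 := by exact_mod_cast hpos.ne'
  unfold levyIntegrand levyBound
  rw [← ha]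
  rcases le_total ‖x‖ 1 with h1 | h1
  · have e : Complex.exp (Complex.I * (a : ℂ)) - 1 - Complex.I * (a : ℂ) / ((1 + ‖x‖ ^ 2 : ℝ) : ℂ) =
        (Complex.exp (Complex.I * (a : ℂ)) - 1 - Complex.I * (a : ℂ)) +
          Complex.I * ((a * (‖x‖ ^ 2 / (1 + ‖x‖ ^ 2)) : ℝ) : ℂ) := by
      push_cast at hne ⊢
      field_simp
      ring
    have hmin : min 1 (‖x‖ ^ 2) = ‖x‖ ^ 2 := min_eq_right (by nlinarith)
    rw [e, hmin]
    have hfrac : ‖x‖ ^ 2 / (1 + ‖x‖ ^ 2) ≤ ‖x‖ ^ 2 := div_le_self (by positivity) (by nlinarith)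
    have h2 : ‖Complex.I * ((a * (‖x‖ ^ 2 / (1 + ‖x‖ ^ 2)) : ℝ) : ℂ)‖ ≤ ‖t‖ * ‖x‖ ^ 2 := by
      rw [norm_mul, Complex.norm_I, one_mul, Complex.norm_real, Real.norm_eq_abs, abs_mul,
        abs_of_nonneg (div_nonneg (sq_nonneg ‖x‖) hpos.le)]
      calc |a| * (‖x‖ ^ 2 / (1 + ‖x‖ ^ 2)) ≤ (‖t‖ * 1) * ‖x‖ ^ 2 := by
            gcongr; exact hat.trans (by gcongr)
        _ = _ := by ring
    have h3 := norm_exp_I_mul_sub_le a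
    have h4 : a ^ 2 ≤ ‖t‖ ^ 2 * ‖x‖ ^ 2 := by
      rw [← sq_abs, ← mul_pow]; gcongr
    refine (norm_add_le _ _).trans ?_
    nlinarith [sq_nonneg ‖x‖]
  · have hmin : min 1 (‖x‖ ^ 2) = 1 := min_eq_left (by nlinarith)
    rw [hmin, mul_one]
    have h2 : ‖Complex.exp (Complex.I * (a : ℂ))‖ = 1 := by
      rw [mul_comm]; exact Complex.norm_exp_ofReal_mul_I a
    have h3 : ‖Complex.I * (a : ℂ) / ((1 + ‖x‖ ^ 2 : ℝ) : ℂ)‖ ≤ ‖t‖ := by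
      rw [norm_div, norm_mul, Complex.norm_I, one_mul, Complex.norm_real, Complex.norm_real,
        Real.norm_of_nonneg hpos.le, Real.norm_eq_abs, div_le_iff₀ hpos]
      refine hat.trans ?_
      gcongr
      nlinarith
    calc _ ≤ ‖Complex.exp (Complex.I * (a : ℂ))‖ + ‖(1 : ℂ)‖ + ‖Complex.I * (a : ℂ) /
          ((1 + ‖x‖ ^ 2 : ℝ) : ℂ)‖ :=
          (norm_sub_le _ _).trans (add_le_add_left (norm_sub_le _ _) _)
      _ ≤ _ := by rw [h2, norm_one]; nlinarith [sq_nonneg ‖t‖]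

variable {φ φ' : Measure (EuclideanSpace ℝ (Fin m))}

lemma integrable_truncation (hφ : truncatedSecondMoment φ ≠ ∞) :
    Integrable (fun x : EuclideanSpace ℝ (Fin m) => min 1 (‖x‖ ^ 2)) φ := by
  refine ⟨by fun_prop, ?_⟩
  rw [hasFiniteIntegral_iff_ofReal (ae_of_all _ fun x => by positivity)]
  exact hφ.lt_top

lemma integral_truncation : ∫ x : EuclideanSpace ℝ (Fin m), min 1 (‖x‖ ^ 2) ∂φ = (truncatedSecondMoment φ).toReal :=
  integral_eq_lintegral_of_nonneg_ae (ae_of_all _ fun x => by positivity) (by fun_prop)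

lemma integrable_levyIntegrand (hφ : truncatedSecondMoment φ ≠ ∞) (t : EuclideanSpace ℝ (Fin m)) :
    Integrable (levyIntegrand t) φ :=
  ((integrable_truncation hφ).const_mul _).mono' (continuous_levyIntegrand t).aestronglyMeasurable
    (ae_of_all _ fun x => norm_levyIntegrand_le t x)

lemma norm_integral_levyIntegrand_le (hφ : truncatedSecondMoment φ ≠ ∞) (t : EuclideanSpace ℝ (Fin m)) :
    ‖∫ x, levyIntegrand t x ∂φ‖ ≤ levyBound ‖t‖ * (truncatedSecondMoment φ).toReal := by
  rw [← integral_truncation, ← integral_const_mul]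
  exact norm_integral_le_of_norm_le ((integrable_truncation hφ).const_mul _)
    (ae_of_all _ fun x => norm_levyIntegrand_le t x)

/-! ### Continuity of the exponent -/

lemma continuous_integral_levyIntegrand (hφ : truncatedSecondMoment φ ≠ ∞) :
    Continuous fun t : EuclideanSpace ℝ (Fin m) => ∫ x, levyIntegrand t x ∂φ := by
  rw [continuous_iff_continuousAt]
  intro t
  refine continuousAt_of_dominated (bound := fun x => levyBound (‖t‖ + 1) * min 1 (‖x‖ ^ 2))
    (Eventually.of_forall fun s => (continuous_levyIntegrand s).aestronglyMeasurable) ?_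
    ((integrable_truncation hφ).const_mul _)
    (ae_of_all _ fun x => (continuous_levyIntegrand_left x).continuousAt)
  have h1 : ∀ᶠ s in 𝓝 t, ‖s‖ < ‖t‖ + 1 :=
    continuous_norm.continuousAt.eventually_lt continuousAt_const (by simp)
  filter_upwards [h1] with s hs
  refine ae_of_all _ fun x => (norm_levyIntegrand_le s x).trans ?_
  gcongr
  exact levyBound_mono (norm_nonneg _) hs.le

lemma continuous_levyKhintchineExponent (γ : EuclideanSpace ℝ (Fin m)) (Q : Matrix (Fin m) (Fin m) ℝ)
    (hφ : truncatedSecondMoment φ ≠ ∞) : Continuous (levyKhintchineExponent γ Q φ) := by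
  have h1 : Continuous fun t : EuclideanSpace ℝ (Fin m) => Matrix.toEuclideanLin Q t :=
    LinearMap.continuous_of_finiteDimensional _
  have h2 := continuous_integral_levyIntegrand hφ
  unfold levyKhintchineExponent
  fun_prop

lemma levyKhintchineExponent_zero (γ : EuclideanSpace ℝ (Fin m)) (Q : Matrix (Fin m) (Fin m) ℝ) :
    levyKhintchineExponent γ Q φ 0 = 0 := by
  simp [levyKhintchineExponent, levyIntegrand]

/-- Continuous logarithms that vanish at the origin are unique. -/
lemma eq_of_exp_eq_exp {f g : EuclideanSpace ℝ (Fin m) → ℂ} (hf : Continuous f) (hg : Continuous g) (hf0 : f 0 = 0)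
    (hg0 : g 0 = 0) (h : ∀ t, Complex.exp (f t) = Complex.exp (g t)) : f = g := by
  -- The difference is `2πi` times an integer that varies continuously over a connected space, so it
  -- keeps its value `0` from the origin.
  choose n hn using fun t => Complex.exp_eq_exp_iff_exists_int.1 (h t)
  have hn' : ∀ t, ((n t : ℤ) : ℝ) = (f t - g t).im / (2 * Real.pi) := fun t => by
    rw [hn t, add_sub_cancel_left]
    have : ((n t : ℂ) * (2 * (Real.pi : ℂ) * Complex.I)).im = n t * (2 * Real.pi) := by
      simp
    rw [this, mul_div_cancel_right₀ _ (by positivity)]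
  have hc : Continuous n := by
    rw [Int.isClosedEmbedding_coe_real.isEmbedding.continuous_iff]
    have : ((fun k : ℤ => (k : ℝ)) ∘ n) = fun t => (f t - g t).im / (2 * Real.pi) := funext hn'
    rw [this]
    fun_prop
  funext t
  have h1 : n t = n 0 := PreconnectedSpace.constant inferInstance hc
  have h2 : n 0 = 0 := by
    have := hn' 0
    rw [hf0, hg0] at this
    simpa using this
  rw [hn t, h1, h2]; simp

/-! ### Second differences and uniqueness of the triplet -/

/-- The function `x ↦ 1 - cos ⟨h, x⟩` with values in `[0, ∞]`. -/
def cosWeight (h x : EuclideanSpace ℝ (Fin m)) : ℝ≥0∞ := ENNReal.ofReal (1 - Real.cos (inner ℝ h x))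

lemma measurable_cosWeight (h : EuclideanSpace ℝ (Fin m)) : Measurable (cosWeight h) := by
  unfold cosWeight; fun_prop

lemma cosWeight_lt_top (h x : EuclideanSpace ℝ (Fin m)) : cosWeight h x < ∞ := ENNReal.ofReal_lt_top

lemma toReal_cosWeight (h x : EuclideanSpace ℝ (Fin m)) : (cosWeight h x).toReal = 1 - Real.cos (inner ℝ h x) :=
  ENNReal.toReal_ofReal (by linarith [Real.cos_le_one (inner ℝ h x)])

lemma re_levyIntegrand (t x : EuclideanSpace ℝ (Fin m)) : (levyIntegrand t x).re = -(cosWeight t x).toReal := by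
  rw [toReal_cosWeight]
  have h1 : (Complex.exp (Complex.I * ((inner ℝ t x : ℝ) : ℂ))).re = Real.cos (inner ℝ t x) := by
    rw [mul_comm]; exact Complex.exp_ofReal_mul_I_re _
  have h2 : (Complex.I * ((inner ℝ t x : ℝ) : ℂ) / ((1 + ‖x‖ ^ 2 : ℝ) : ℂ)).re = 0 := by
    rw [mul_div_assoc, ← Complex.ofReal_div, Complex.I_mul_re, Complex.ofReal_im, neg_zero]
  rw [levyIntegrand, Complex.sub_re, Complex.sub_re, h1, h2]
  simp

/-- Shows that the weight `1 - cos⟨h, x⟩` makes `φ` a finite measure, even when `φ` is infinite near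
the origin. -/
lemma lintegral_cosWeight (hφ : truncatedSecondMoment φ ≠ ∞) (h : EuclideanSpace ℝ (Fin m)) :
    ∫⁻ x, cosWeight h x ∂φ = ENNReal.ofReal (-(∫ x, levyIntegrand h x ∂φ).re) := by
  have hi := (integrable_levyIntegrand hφ h).re
  have e : ∀ x, -(levyIntegrand h x).re = 1 - Real.cos (inner ℝ h x) := fun x => by
    rw [re_levyIntegrand, neg_neg, toReal_cosWeight]
  have h1 : -(∫ x, levyIntegrand h x ∂φ).re = ∫ x, (1 - Real.cos (inner ℝ h x)) ∂φ := by
    have := integral_re (integrable_levyIntegrand hφ h)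
    simp only [RCLike.re_eq_complex_re] at this
    rw [← this, ← integral_neg]
    exact integral_congr_ae (ae_of_all _ e)
  rw [h1, ofReal_integral_eq_lintegral_ofReal]
  · rfl
  · exact (hi.neg).congr (ae_of_all _ e)
  · exact ae_of_all _ fun x => by
      change 0 ≤ 1 - Real.cos _
      linarith [Real.cos_le_one (inner ℝ h x)]

lemma isFiniteMeasure_cosWeight (hφ : truncatedSecondMoment φ ≠ ∞) (h : EuclideanSpace ℝ (Fin m)) :
    IsFiniteMeasure (φ.withDensity (cosWeight h)) :=
  isFiniteMeasure_withDensity (by rw [lintegral_cosWeight hφ]; exact ENNReal.ofReal_ne_top)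

/-- The constant and the compensator are affine in `t` and cancel; the exponentials combine to
`e^{i⟨t, x⟩}(1 - cos⟨h, x⟩)`. -/
lemma levyIntegrand_second_difference (t h x : EuclideanSpace ℝ (Fin m)) :
    levyIntegrand t x - (levyIntegrand (t + h) x + levyIntegrand (t - h) x) / 2 =
      ((cosWeight h x).toReal : ℂ) * Complex.exp ((inner ℝ x t : ℝ) * Complex.I) := by
  rw [toReal_cosWeight, real_inner_comm t x]
  simp only [levyIntegrand, inner_add_left, inner_sub_left]
  set a : ℝ := inner ℝ t x
  set b : ℝ := inner ℝ h x
  push_cast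
  rw [Complex.cos, mul_add, mul_sub, Complex.exp_add, sub_eq_add_neg (Complex.I * (a : ℂ)),
    Complex.exp_add, mul_comm (a : ℂ) Complex.I, mul_comm (b : ℂ) Complex.I, neg_mul,
    mul_comm (b : ℂ) Complex.I]
  ring

/-- Second differences of the exponent are the characteristic function of a finite measure. -/
lemma levyKhintchineExponent_second_difference (γ : EuclideanSpace ℝ (Fin m)) {Q : Matrix (Fin m) (Fin m) ℝ}
    (hQ : Q.PosSemidef) (hφ : truncatedSecondMoment φ ≠ ∞) (t h : EuclideanSpace ℝ (Fin m)) :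
    levyKhintchineExponent γ Q φ t - (levyKhintchineExponent γ Q φ (t + h) +
        levyKhintchineExponent γ Q φ (t - h)) / 2 =
      charFun (ENNReal.ofReal ((1 / 2) * inner ℝ (Matrix.toEuclideanLin Q h) h) • Measure.dirac 0 +
        φ.withDensity (cosWeight h)) t := by
  have := isFiniteMeasure_cosWeight hφ h
  have hq : 0 ≤ (inner ℝ (Matrix.toEuclideanLin Q h) h : ℝ) := by
    have := (Matrix.isPositive_toEuclideanLin_iff.2 hQ).inner_nonneg_left h
    exact this
  have hb : ∀ μ : Measure (EuclideanSpace ℝ (Fin m)), IsFiniteMeasure μ →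
      Integrable (fun x : EuclideanSpace ℝ (Fin m) => Complex.exp ((inner ℝ x t : ℝ) * Complex.I)) μ := fun μ _ =>
    (integrable_const (1 : ℝ)).mono' (by fun_prop)
      (ae_of_all _ fun x => (Complex.norm_exp_ofReal_mul_I _).le)
  have hfin : IsFiniteMeasure (ENNReal.ofReal ((1 / 2) *
      inner ℝ (Matrix.toEuclideanLin Q h) h) • (Measure.dirac 0 : Measure (EuclideanSpace ℝ (Fin m)))) :=
    Measure.smul_finite _ ENNReal.ofReal_ne_top
  have h1 : charFun (ENNReal.ofReal ((1 / 2) *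
      inner ℝ (Matrix.toEuclideanLin Q h) h) • Measure.dirac 0 + φ.withDensity (cosWeight h)) t =
      (((1 / 2) * inner ℝ (Matrix.toEuclideanLin Q h) h : ℝ) : ℂ) +
        ∫ x, (levyIntegrand t x - (levyIntegrand (t + h) x + levyIntegrand (t - h) x) / 2) ∂φ := by
    rw [charFun_apply, integral_add_measure (hb _ hfin) (hb _ this), integral_smul_measure,
      integral_dirac, integral_withDensity_eq_integral_toReal_smul (measurable_cosWeight h)
      (ae_of_all _ (cosWeight_lt_top h)), ENNReal.toReal_ofReal (by positivity)]
    congr 1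
    · simp
    · refine integral_congr_ae (ae_of_all _ fun x => ?_)
      simp only [levyIntegrand_second_difference, Complex.real_smul]
  have i0 := integrable_levyIntegrand hφ
  have i1 : Integrable (fun x => (levyIntegrand (t + h) x + levyIntegrand (t - h) x) / 2) φ :=
    ((i0 _).add (i0 _)).div_const 2
  rw [h1, integral_sub (i0 _) i1, integral_div, integral_add (i0 _) (i0 _)]
  simp only [levyKhintchineExponent, map_add, map_sub, inner_add_left, inner_add_right,
    inner_sub_left, inner_sub_right]
  push_cast
  ring

/-- A measure without mass at the origin is determined by its cosine weighted versions. -/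
lemma eq_of_cosWeight_eq (h0 : φ {0} = 0) (h0' : φ' {0} = 0)
    (h : ∀ t, φ.withDensity (cosWeight t) = φ'.withDensity (cosWeight t)) : φ = φ' := by
  -- Countably many directions suffice: where the weight is nonzero it can be divided out, and these
  -- sets cover everything but the origin.
  let D := TopologicalSpace.denseSeq (EuclideanSpace ℝ (Fin m))
  let s : ℕ → Set (EuclideanSpace ℝ (Fin m)) := fun n => {x | cosWeight (D n) x ≠ 0}
  have hs : ∀ n, MeasurableSet (s n) := fun n =>
    (measurable_cosWeight (D n) (measurableSet_singleton 0)).compl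
  have hU : ∀ x : EuclideanSpace ℝ (Fin m), x ≠ 0 → x ∈ ⋃ n, s n := by
    intro x hx
    by_contra hcon
    have h1 : ∀ n, Real.cos (inner ℝ (D n) x) = 1 := fun n => by
      have h2 : cosWeight (D n) x = 0 := by
        by_contra h3
        exact hcon (Set.mem_iUnion.2 ⟨n, h3⟩)
      have h3 := toReal_cosWeight (D n) x
      rw [h2, ENNReal.toReal_zero] at h3
      linarith
    have h2 : (fun t : EuclideanSpace ℝ (Fin m) => Real.cos (inner ℝ t x)) = fun _ => 1 :=
      (TopologicalSpace.denseRange_denseSeq (EuclideanSpace ℝ (Fin m))).equalizer (by fun_prop) (by fun_prop)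
        (funext h1)
    -- By density the cosine would be `1` in every direction; this choice makes the inner product
    -- `π`.
    have h3 := congrFun h2 ((Real.pi / ‖x‖ ^ 2) • x)
    have : ‖x‖ ^ 2 ≠ 0 := by simpa using hx
    simp only [real_inner_smul_left, real_inner_self_eq_norm_sq, div_mul_cancel₀ _ this,
      Real.cos_pi] at h3
    norm_num at h3
  have hr : ∀ (μ : Measure (EuclideanSpace ℝ (Fin m))) n, (μ.withDensity (cosWeight (D n))).withDensity
      (cosWeight (D n))⁻¹ = μ.restrict (s n) := by
    intro μ n
    rw [← withDensity_mul _ (measurable_cosWeight _) (measurable_cosWeight _).inv,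
      ← withDensity_indicator_one (hs n)]
    congr 1
    funext x
    by_cases hx : cosWeight (D n) x = 0
    · simp [s, hx]
    · simp [s, hx, ENNReal.mul_inv_cancel hx (cosWeight_lt_top _ _).ne]
  have hre : ∀ μ : Measure (EuclideanSpace ℝ (Fin m)), μ {0} = 0 → μ.restrict (⋃ n, s n) = μ := fun μ hμ =>
    Measure.restrict_eq_self_of_ae_mem <| by
      have h1 : ∀ᵐ x ∂μ, x ≠ 0 := by simpa [ae_iff] using hμ
      exact h1.mono hU
  rw [← hre φ h0, ← hre φ' h0', Measure.restrict_iUnion_congr]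
  intro n
  rw [← hr φ n, ← hr φ' n, h]

lemma toEuclideanLin_eq_of_quadratic_eq {Q Q' : Matrix (Fin m) (Fin m) ℝ} (hQ : Q.IsHermitian)
    (hQ' : Q'.IsHermitian) (h : ∀ t : EuclideanSpace ℝ (Fin m), (inner ℝ (Matrix.toEuclideanLin Q t) t : ℝ) =
      inner ℝ (Matrix.toEuclideanLin Q' t) t) : Q = Q' := by
  have h1 : (Matrix.toEuclideanLin Q - Matrix.toEuclideanLin Q').IsSymmetric :=
    (Matrix.isSymmetric_toEuclideanLin_iff.2 hQ).sub (Matrix.isSymmetric_toEuclideanLin_iff.2 hQ')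
  have h2 := h1.inner_map_self_eq_zero.1 fun t => by
    rw [LinearMap.sub_apply, inner_sub_left, h t, sub_self]
  exact Matrix.toEuclideanLin.injective (sub_eq_zero.1 h2)

/-- Uniqueness of the Lévy–Khintchine triplet. -/
lemma HasLevyTriplet.unique {μ : Measure (EuclideanSpace ℝ (Fin m))} {γ γ' : EuclideanSpace ℝ (Fin m)} {Q Q' : Matrix (Fin m) (Fin m) ℝ}
    (h : HasLevyTriplet μ γ Q φ) (h' : HasLevyTriplet μ γ' Q' φ') :
    γ = γ' ∧ Q = Q' ∧ φ = φ' := by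
  have hφ := h.isLevyMeasure.moment_lt_top.ne
  have hφ' := h'.isLevyMeasure.moment_lt_top.ne
  have hψ : levyKhintchineExponent γ Q φ = levyKhintchineExponent γ' Q' φ' :=
    eq_of_exp_eq_exp (continuous_levyKhintchineExponent _ _ hφ)
      (continuous_levyKhintchineExponent _ _ hφ') (levyKhintchineExponent_zero _ _)
      (levyKhintchineExponent_zero _ _) fun t => by rw [← h.charFun_eq, h'.charFun_eq]
  -- Equal exponents have equal second differences, and finite measures are determined by their
  -- characteristic functions.
  have hmeas : ∀ s : EuclideanSpace ℝ (Fin m), ENNReal.ofReal ((1 / 2) * inner ℝ (Matrix.toEuclideanLin Q s) s) •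
      Measure.dirac 0 + φ.withDensity (cosWeight s) =
      ENNReal.ofReal ((1 / 2) * inner ℝ (Matrix.toEuclideanLin Q' s) s) •
      Measure.dirac 0 + φ'.withDensity (cosWeight s) := fun s => by
    have := isFiniteMeasure_cosWeight hφ s
    have := isFiniteMeasure_cosWeight hφ' s
    have (c : ℝ) : IsFiniteMeasure (ENNReal.ofReal c • (Measure.dirac 0 : Measure (EuclideanSpace ℝ (Fin m)))) :=
      Measure.smul_finite _ ENNReal.ofReal_ne_top
    refine Measure.ext_of_charFun (funext fun t => ?_)
    rw [← levyKhintchineExponent_second_difference γ h.posSemidef hφ,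
      ← levyKhintchineExponent_second_difference γ' h'.posSemidef hφ', hψ]
  -- The weight vanishes at the origin, so the mass there is exactly the quadratic form of `Q`; the
  -- remaining part is the weighted Lévy measure.
  have hzero : ∀ (μ : Measure (EuclideanSpace ℝ (Fin m))) (s : EuclideanSpace ℝ (Fin m)), μ.withDensity (cosWeight s) {0} = 0 := fun μ s => by
    rw [withDensity_apply _ (measurableSet_singleton 0)]
    refine (setLIntegral_congr_fun (measurableSet_singleton 0) (g := 0) fun x hx => ?_).trans
      (by simp)
    simp [Set.mem_singleton_iff.1 hx, cosWeight]
  have hquad : ∀ s : EuclideanSpace ℝ (Fin m), (inner ℝ (Matrix.toEuclideanLin Q s) s : ℝ) =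
      inner ℝ (Matrix.toEuclideanLin Q' s) s := fun s => by
    have h1 := congrArg (fun μ : Measure (EuclideanSpace ℝ (Fin m)) => μ {0}) (hmeas s)
    simp only [Measure.add_apply, hzero, add_zero, Measure.smul_apply, smul_eq_mul,
      Measure.dirac_apply_of_mem (Set.mem_singleton (0 : EuclideanSpace ℝ (Fin m))), mul_one] at h1
    have hq : ∀ R : Matrix (Fin m) (Fin m) ℝ, R.PosSemidef →
        0 ≤ (1 / 2) * (inner ℝ (Matrix.toEuclideanLin R s) s : ℝ) := fun R hR =>
      mul_nonneg (by norm_num) ((Matrix.isPositive_toEuclideanLin_iff.2 hR).inner_nonneg_left s)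
    rw [ENNReal.ofReal_eq_ofReal_iff (hq _ h.posSemidef) (hq _ h'.posSemidef)] at h1
    linarith
  have hQ : Q = Q' := toEuclideanLin_eq_of_quadratic_eq h.posSemidef.isHermitian
    h'.posSemidef.isHermitian hquad
  have hφe : φ = φ' := by
    refine eq_of_cosWeight_eq h.isLevyMeasure.zero h'.isLevyMeasure.zero fun s => ?_
    ext B hB
    have h1 := congrArg (fun μ : Measure (EuclideanSpace ℝ (Fin m)) => μ B) (hmeas s)
    simp only [Measure.add_apply, hquad s] at h1
    refine (ENNReal.add_right_inj ?_).1 h1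
    rw [Measure.smul_apply, smul_eq_mul]
    exact ENNReal.mul_ne_top ENNReal.ofReal_ne_top (measure_ne_top _ _)
  refine ⟨?_, hQ, hφe⟩
  subst hQ hφe
  refine ext_inner_right ℝ fun t => ?_
  have h1 := congrFun hψ t
  simp only [levyKhintchineExponent, add_left_inj, sub_left_inj] at h1
  exact_mod_cast mul_left_cancel₀ Complex.I_ne_zero h1

end LevyKhintchine

/-! ### Additivity of the random measure and of its triplets. -/

section randomMeasure

variable {S Ω : Type*} [MeasurableSpace Ω] {m : ℕ} {𝒮 : Set (Set S)} {P : Measure Ω}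
  {M : Set S → Ω → EuclideanSpace ℝ (Fin m)}

/-! ### Finite additivity -/

lemma map_biUnion_range {V : Type*} [AddCommMonoid V] {T : Set S → V} (h : IsDeltaRing 𝒮)
    (h0 : T ∅ = 0)
    (hT : ∀ A ∈ 𝒮, ∀ B ∈ 𝒮, Disjoint A B → T (A ∪ B) = T A + T B) {A : ℕ → Set S}
    (hA : ∀ n, A n ∈ 𝒮) (hd : Pairwise (fun i j => Disjoint (A i) (A j))) (N : ℕ) :
    T (⋃ n ∈ Finset.range N, A n) = ∑ n ∈ Finset.range N, T (A n) := by
  induction N with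
  | zero => simpa using h0
  | succ N ih =>
    rw [Finset.sum_range_succ, ← ih, Finset.range_add_one, Finset.set_biUnion_insert, Set.union_comm]
    refine hT _ (h.isSetRing.biUnion_mem _ fun n _ => hA n) _ (hA N) ?_
    simp only [Set.disjoint_iUnion_left, Finset.mem_range]
    exact fun i hi => hd hi.ne

lemma IsISRM.empty (h : IsDeltaRing 𝒮) (hM : IsISRM 𝒮 P M) : M ∅ =ᵐ[P] 0 := by
  have h1 := hM.sigma_additive (fun _ => ∅) (fun _ => h.isSetRing.empty_mem) (fun _ _ _ => by simp)
    (by simpa using h.isSetRing.empty_mem)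
  filter_upwards [h1] with ω hω
  have h2 := ((tendsto_add_atTop_iff_nat 1).2 hω).sub hω
  simp only [Finset.sum_range_succ, add_sub_cancel_left, sub_self] at h2
  exact tendsto_nhds_unique tendsto_const_nhds h2

lemma IsISRM.union (h : IsDeltaRing 𝒮) (hM : IsISRM 𝒮 P M) {A B : Set S} (hA : A ∈ 𝒮)
    (hB : B ∈ 𝒮) (hAB : Disjoint A B) : M (A ∪ B) =ᵐ[P] M A + M B := by
  -- The axiom speaks of sequences only, so the pair is padded with empty sets; partial sums are
  -- constant from two terms on.
  let C : ℕ → Set S := fun n => if n = 0 then A else if n = 1 then B else ∅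
  have hC : (⋃ n, C n) = A ∪ B := by
    ext x
    simp only [Set.mem_iUnion, Set.mem_union, C]
    constructor
    · rintro ⟨n, hn⟩
      split_ifs at hn <;> simp_all
    · rintro (hx | hx)
      · exact ⟨0, by simpa⟩
      · exact ⟨1, by simpa⟩
  have h1 := hM.sigma_additive C (fun n => by
      simp only [C]; split_ifs <;> first | assumption | exact h.isSetRing.empty_mem)
    (fun i j hij => by
      simp only [C]
      split_ifs <;> simp_all [disjoint_comm]) (by rw [hC]; exact h.isSetRing.union_mem hA hB)
  rw [hC] at h1
  filter_upwards [h1, hM.empty h] with ω h1 h0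
  have h2 : ∀ N : ℕ, ∑ n ∈ Finset.range (N + 2), M (C n) ω = M A ω + M B ω := fun N => by
    induction N with
    | zero => simp [Finset.sum_range_succ, C]
    | succ N ih => rw [Finset.sum_range_succ, ih]; simp [C, h0]
  have h3 := (tendsto_add_atTop_iff_nat 2).2 h1
  simp only [h2] at h3
  exact tendsto_nhds_unique h3 tendsto_const_nhds

/-! ### Remainders -/

/-- The values of the random measure on the remainders of a disjoint union tend to `0`. -/
lemma IsISRM.tendsto_remainder (h : IsDeltaRing 𝒮) (hM : IsISRM 𝒮 P M) {A : ℕ → Set S}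
    (hA : ∀ n, A n ∈ 𝒮) (hd : Pairwise (fun i j => Disjoint (A i) (A j)))
    (hU : (⋃ n, A n) ∈ 𝒮) : ∀ᵐ ω ∂P, Tendsto
      (fun N : ℕ => M ((⋃ n, A n) \ ⋃ n ∈ Finset.range N, A n) ω) atTop (𝓝 0) := by
  have hB : ∀ N, (⋃ n ∈ Finset.range N, A n) ∈ 𝒮 := fun N =>
    h.isSetRing.biUnion_mem _ fun n _ => hA n
  have h1 : ∀ᵐ ω ∂P, ∀ N, M (⋃ n ∈ Finset.range N, A n) ω = ∑ n ∈ Finset.range N, M (A n) ω := by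
    rw [ae_all_iff]
    intro N
    induction N with
    | zero => simpa using! hM.empty h
    | succ N ih =>
      have h2 := hM.union h (hB N) (hA N) (by
        simp only [Set.disjoint_iUnion_left, Finset.mem_range]
        exact fun i hi => hd hi.ne)
      filter_upwards [ih, h2] with ω h3 h4
      rw [Finset.range_add_one, Finset.set_biUnion_insert, Set.union_comm, h4,
        ← Finset.range_add_one, Finset.sum_range_succ, ← h3, Pi.add_apply]
  have h2 : ∀ᵐ ω ∂P, ∀ N, M (⋃ n, A n) ω = M (⋃ n ∈ Finset.range N, A n) ω +
      M ((⋃ n, A n) \ ⋃ n ∈ Finset.range N, A n) ω := by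
    rw [ae_all_iff]
    intro N
    have := hM.union h (hB N) (h.isSetRing.sdiff_mem hU (hB N)) Set.disjoint_sdiff_right
    rw [Set.union_sdiff_cancel (Set.iUnion₂_subset fun n _ => Set.subset_iUnion A n)] at this
    exact this
  filter_upwards [h1, h2, hM.sigma_additive A hA hd hU] with ω h1 h2 h3
  have h4 : ∀ N, M ((⋃ n, A n) \ ⋃ n ∈ Finset.range N, A n) ω =
      M (⋃ n, A n) ω - ∑ n ∈ Finset.range N, M (A n) ω := fun N => by
    rw [h2 N, h1 N, add_sub_cancel_left]
  simp only [h4]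
  simpa using h3.const_sub (M (⋃ n, A n) ω)

variable {γ : Set S → EuclideanSpace ℝ (Fin m)} {Q : Set S → Matrix (Fin m) (Fin m) ℝ}
  {φ : Set S → Measure (EuclideanSpace ℝ (Fin m))}

lemma truncatedSecondMoment_add (φ φ' : Measure (EuclideanSpace ℝ (Fin m))) :
    truncatedSecondMoment (φ + φ') = truncatedSecondMoment φ + truncatedSecondMoment φ' :=
  lintegral_add_measure _ _ _

lemma hasLevyTriplet_dirac_zero :
    HasLevyTriplet (Measure.dirac (0 : EuclideanSpace ℝ (Fin m))) 0 0 0 where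
  posSemidef := .zero
  isLevyMeasure := ⟨by simp, by simp [truncatedSecondMoment]⟩
  charFun_eq t := by simp [levyKhintchineExponent]

lemma levyKhintchineExponent_add {γ γ' : EuclideanSpace ℝ (Fin m)}
    {Q Q' : Matrix (Fin m) (Fin m) ℝ} {φ φ' : Measure (EuclideanSpace ℝ (Fin m))}
    (hφ : truncatedSecondMoment φ ≠ ∞) (hφ' : truncatedSecondMoment φ' ≠ ∞)
    (t : EuclideanSpace ℝ (Fin m)) :
    levyKhintchineExponent (γ + γ') (Q + Q') (φ + φ') t =
      levyKhintchineExponent γ Q φ t + levyKhintchineExponent γ' Q' φ' t := by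
  unfold levyKhintchineExponent
  rw [integral_add_measure (integrable_levyIntegrand hφ t) (integrable_levyIntegrand hφ' t),
    map_add, LinearMap.add_apply, inner_add_left, inner_add_left]
  push_cast
  ring

lemma HasLevyTriplet.map_add {X Y : Ω → EuclideanSpace ℝ (Fin m)} (hX : Measurable X)
    (hY : Measurable Y) (hXY : IndepFun X Y P) [IsProbabilityMeasure P]
    {γ γ' : EuclideanSpace ℝ (Fin m)}
    {Q Q' : Matrix (Fin m) (Fin m) ℝ} {φ φ' : Measure (EuclideanSpace ℝ (Fin m))}
    (h : HasLevyTriplet (P.map X) γ Q φ) (h' : HasLevyTriplet (P.map Y) γ' Q' φ') :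
    HasLevyTriplet (P.map (X + Y)) (γ + γ') (Q + Q') (φ + φ') where
  posSemidef := h.posSemidef.add h'.posSemidef
  isLevyMeasure := ⟨by simp [h.isLevyMeasure.zero, h'.isLevyMeasure.zero], by
    rw [truncatedSecondMoment_add]
    exact ENNReal.add_lt_top.2 ⟨h.isLevyMeasure.moment_lt_top, h'.isLevyMeasure.moment_lt_top⟩⟩
  charFun_eq t := by
    rw [hXY.charFun_map_add_eq_mul hX.aemeasurable hY.aemeasurable, Pi.mul_apply, h.charFun_eq,
      h'.charFun_eq, ← Complex.exp_add, levyKhintchineExponent_add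
      h.isLevyMeasure.moment_lt_top.ne h'.isLevyMeasure.moment_lt_top.ne]

variable [IsProbabilityMeasure P]

lemma IsISRM.triplet_empty (h : IsDeltaRing 𝒮) (hM : IsISRM 𝒮 P M)
    (hid : ∀ A ∈ 𝒮, HasLevyTriplet (P.map (M A)) (γ A) (Q A) (φ A)) :
    γ ∅ = 0 ∧ Q ∅ = 0 ∧ φ ∅ = 0 := by
  have h1 := hid ∅ h.isSetRing.empty_mem
  rw [Measure.map_congr (hM.empty h)] at h1
  have h2 : P.map (0 : Ω → EuclideanSpace ℝ (Fin m)) = Measure.dirac 0 :=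
    (Measure.map_const P (0 : EuclideanSpace ℝ (Fin m))).trans (by simp)
  rw [h2] at h1
  exact h1.unique hasLevyTriplet_dirac_zero

/-- Independence enters here: characteristic functions multiply, exponents add, and uniqueness of
the triplet separates the three components. -/
lemma IsISRM.triplet_union (h : IsDeltaRing 𝒮) (hM : IsISRM 𝒮 P M)
    (hid : ∀ A ∈ 𝒮, HasLevyTriplet (P.map (M A)) (γ A) (Q A) (φ A)) {A B : Set S} (hA : A ∈ 𝒮)
    (hB : B ∈ 𝒮) (hAB : Disjoint A B) :
    γ (A ∪ B) = γ A + γ B ∧ Q (A ∪ B) = Q A + Q B ∧ φ (A ∪ B) = φ A + φ B := by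
  have h1 := hid _ (h.isSetRing.union_mem hA hB)
  rw [Measure.map_congr (hM.union h hA hB hAB)] at h1
  have hind : IndepFun (M A) (M B) P := by
    have := hM.indep 2 ![A, B] (fun i => by fin_cases i <;> simpa) (fun i j hij => by
      fin_cases i <;> fin_cases j <;> simp_all [disjoint_comm])
    simpa using this.indepFun (i := 0) (j := 1) (by simp)
  exact h1.unique ((hid A hA).map_add (hM.measurable A hA) (hM.measurable B hB) hind (hid B hB))

lemma tendsto_charFun_of_tendsto_zero {X : ℕ → Ω → EuclideanSpace ℝ (Fin m)}
    (hX : ∀ n, Measurable (X n)) (h : ∀ᵐ ω ∂P, Tendsto (fun n => X n ω) atTop (𝓝 0))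
    (t : EuclideanSpace ℝ (Fin m)) :
    Tendsto (fun n => charFun (P.map (X n)) t) atTop (𝓝 1) := by
  have h1 : ∀ n, charFun (P.map (X n)) t =
      ∫ ω, Complex.exp ((inner ℝ (X n ω) t : ℝ) * Complex.I) ∂P := fun n => by
    rw [charFun_apply, integral_map (hX n).aemeasurable (by fun_prop)]
  simp only [h1]
  have h2 : (1 : ℂ) = ∫ _, (1 : ℂ) ∂P := by simp
  rw [h2]
  refine tendsto_integral_of_dominated_convergence (fun _ => (1 : ℝ)) (fun n => ?_)
    (integrable_const _) (fun n => ae_of_all _ fun ω => (Complex.norm_exp_ofReal_mul_I _).le) ?_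
  · have := hX n
    fun_prop
  · filter_upwards [h] with ω hω
    have hc : Continuous fun x : EuclideanSpace ℝ (Fin m) =>
      Complex.exp ((inner ℝ x t : ℝ) * Complex.I) := by fun_prop
    have := (hc.tendsto 0).comp hω
    rw [inner_zero_left, Complex.ofReal_zero, zero_mul, Complex.exp_zero] at this
    exact this

/-- Integrating the hypothesis in `t` against the standard Gaussian gives `exp (-‖x n‖² / 2) → 1`.
This needs no prior bound on `x n` and no choice of logarithm. -/
lemma tendsto_zero_of_tendsto_exp_inner {x : ℕ → EuclideanSpace ℝ (Fin m)}
    (h : ∀ t, Tendsto (fun n => Complex.exp (Complex.I * (inner ℝ (x n) t : ℝ))) atTop (𝓝 1)) :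
    Tendsto x atTop (𝓝 0) := by
  have h1 : Tendsto (fun n => charFun (stdGaussian (EuclideanSpace ℝ (Fin m))) (x n)) atTop
      (𝓝 1) := by
    simp only [charFun_apply]
    have h2 : (1 : ℂ) = ∫ _, (1 : ℂ) ∂(stdGaussian (EuclideanSpace ℝ (Fin m))) := by simp
    rw [h2]
    refine tendsto_integral_of_dominated_convergence (fun _ => (1 : ℝ)) (fun n => by fun_prop)
      (integrable_const _) (fun n => ae_of_all _ fun ω => (Complex.norm_exp_ofReal_mul_I _).le)
      (ae_of_all _ fun y => ?_)
    simpa only [real_inner_comm, mul_comm] using h y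
  have h2 : ∀ n, charFun (stdGaussian (EuclideanSpace ℝ (Fin m))) (x n) =
      ((Real.exp (-‖x n‖ ^ 2 / 2) : ℝ) : ℂ) := fun n => by
    rw [charFun_stdGaussian]; push_cast; rfl
  simp only [h2] at h1
  have h3 : Tendsto (fun n => Real.exp (-‖x n‖ ^ 2 / 2)) atTop (𝓝 1) :=
    (Complex.continuous_re.tendsto _).comp h1
  have h4 := (Real.continuousAt_log one_ne_zero).tendsto.comp h3
  simp only [Function.comp_def, Real.log_exp, Real.log_one] at h4
  have h5 : Tendsto (fun n => √(-2 * (-‖x n‖ ^ 2 / 2))) atTop (𝓝 (√(-2 * 0))) :=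
    (Real.continuous_sqrt.tendsto _).comp (h4.const_mul (-2))
  rw [tendsto_zero_iff_norm_tendsto_zero]
  rw [mul_zero, Real.sqrt_zero] at h5
  refine Tendsto.congr (fun n => ?_) h5
  rw [show -2 * (-‖x n‖ ^ 2 / 2) = ‖x n‖ ^ 2 by ring, Real.sqrt_sq (norm_nonneg _)]

/-- Both summands are nonnegative for positive semidefinite `Q`, so if the real part of the exponent
tends to `0`, each of them does. -/
lemma neg_re_levyKhintchineExponent {γ : EuclideanSpace ℝ (Fin m)}
    {Q : Matrix (Fin m) (Fin m) ℝ} {φ : Measure (EuclideanSpace ℝ (Fin m))}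
    (hφ : truncatedSecondMoment φ ≠ ∞) (t : EuclideanSpace ℝ (Fin m)) :
    -(levyKhintchineExponent γ Q φ t).re = (1 / 2) * inner ℝ (Matrix.toEuclideanLin Q t) t +
      (∫⁻ x, cosWeight t x ∂φ).toReal := by
  have hnn : 0 ≤ -(∫ x, levyIntegrand t x ∂φ).re := by
    have h1 := integral_re (integrable_levyIntegrand hφ t)
    simp only [RCLike.re_eq_complex_re] at h1
    rw [← h1, ← integral_neg]
    refine integral_nonneg fun x => ?_
    simp [re_levyIntegrand]
  rw [lintegral_cosWeight hφ, ENNReal.toReal_ofReal hnn, levyKhintchineExponent, Complex.add_re,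
    Complex.sub_re, Complex.I_mul_re, Complex.ofReal_im]
  have : ((1 / 2 : ℂ) * ((inner ℝ (Matrix.toEuclideanLin Q t) t : ℝ) : ℂ)).re =
      (1 / 2) * inner ℝ (Matrix.toEuclideanLin Q t) t := by
    rw [Complex.re_mul_ofReal]; norm_num
  rw [this]
  ring

/-- Testing with `e_i ± e_j` gives `2|Q i j| ≤ Q i i + Q j j`. Thus the trace term of the control
measure dominates every entry. -/
lemma abs_apply_le_trace {Q : Matrix (Fin m) (Fin m) ℝ} (hQ : Q.PosSemidef) (i j : Fin m) :
    |Q i j| ≤ Q.trace := by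
  have hdiag : ∀ k, Q k k ≤ Q.trace := fun k =>
    Finset.single_le_sum (f := fun k => Q k k) (fun l _ => hQ.diag_nonneg) (Finset.mem_univ k)
  have hsym : Q j i = Q i j := by simpa using hQ.isHermitian.apply i j
  have key : ∀ c : ℝ, c ^ 2 = 1 → 0 ≤ Q i i + Q j j + 2 * c * Q i j := fun c hc => by
    have h1 := hQ.dotProduct_mulVec_nonneg (Pi.single i 1 + c • Pi.single j 1)
    simp only [star_trivial, Matrix.mulVec_add, Matrix.mulVec_smul, add_dotProduct,
      dotProduct_add, smul_dotProduct, dotProduct_smul, smul_eq_mul, single_dotProduct,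
      Matrix.mulVec_single, one_mul, MulOpposite.op_one, one_smul, Matrix.col_apply, hsym] at h1
    nlinarith [congrArg (· * Q j j) hc]
  have h1 := key 1 (by norm_num)
  have h2 := key (-1) (by norm_num)
  rw [abs_le]
  constructor <;> linarith [hdiag i, hdiag j]

end randomMeasure

/-! ### `σ`-additivity of the triplets. -/

section sigmaAdditivity

variable {S Ω : Type*} [MeasurableSpace Ω] {m : ℕ} {𝒮 : Set (Set S)} {P : Measure Ω}
  [IsProbabilityMeasure P] {M : Set S → Ω → EuclideanSpace ℝ (Fin m)}
  {γ : Set S → EuclideanSpace ℝ (Fin m)} {Q : Set S → Matrix (Fin m) (Fin m) ℝ}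
  {φ : Set S → Measure (EuclideanSpace ℝ (Fin m))}

/-- For real set functions, convergence of the series in the given order is enough. -/
lemma isSigmaAdditive_real {T : Set S → ℝ} (h : IsDeltaRing 𝒮) (h0 : T ∅ = 0)
    (hT : ∀ A : ℕ → Set S, (∀ n, A n ∈ 𝒮) → Pairwise (fun i j => Disjoint (A i) (A j)) →
      (⋃ n, A n) ∈ 𝒮 →
      Tendsto (fun N : ℕ => ∑ n ∈ Finset.range N, T (A n)) atTop (𝓝 (T (⋃ n, A n)))) :
    IsSigmaAdditive 𝒮 T := by
  classical
  intro A hA hd hU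
  -- Replacing the `A n` with `¬ p n` by `∅` keeps the union in `𝒮`, so every subseries converges.
  -- Selecting by sign gives absolute convergence, hence `HasSum`.
  have key : ∀ p : ℕ → Prop, ∃ l, Tendsto
      (fun N : ℕ => ∑ n ∈ Finset.range N, if p n then T (A n) else 0) atTop (𝓝 l) := by
    intro p
    have h1 := hT (fun n => if p n then A n else ∅)
      (fun n => by split_ifs; exacts [hA n, h.isSetRing.empty_mem])
      (fun i j hij => by beta_reduce; split_ifs <;> simp [hd hij])
      (h.iUnion_mem_of_subset hU (fun n => by split_ifs; exacts [hA n, h.isSetRing.empty_mem])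
        (fun n => by split_ifs; exacts [Set.subset_iUnion A n, Set.empty_subset _]))
    refine ⟨_, h1.congr fun N => Finset.sum_congr rfl fun n _ => ?_⟩
    split_ifs <;> simp [h0]
  obtain ⟨a, ha⟩ := key fun n => 0 ≤ T (A n)
  obtain ⟨b, hb⟩ := key fun n => T (A n) < 0
  have ha' : Summable fun n => if 0 ≤ T (A n) then T (A n) else 0 :=
    ((hasSum_iff_tendsto_nat_of_nonneg (fun n => by split_ifs <;> simp_all) a).2 ha).summable
  have hb' : Summable fun n => -(if T (A n) < 0 then T (A n) else 0) :=
    ((hasSum_iff_tendsto_nat_of_nonneg (fun n => by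
      split_ifs with hn <;> [exact neg_nonneg.2 hn.le; simp]) (-b)).2
      (by simpa using hb.neg)).summable
  have hs : Summable fun n => T (A n) := (ha'.sub hb').congr fun n => by
    split_ifs <;> first | simp; done | linarith
  exact (hs.hasSum_iff_tendsto_nat).2 (hT A hA hd hU)

lemma isSigmaAdditive_euclidean {T : Set S → EuclideanSpace ℝ (Fin m)}
    (hT : ∀ i, IsSigmaAdditive 𝒮 fun A => T A i) : IsSigmaAdditive 𝒮 T := by
  intro A hA hd hU
  rw [← (EuclideanSpace.equiv (Fin m) ℝ).hasSum', Pi.hasSum]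
  exact fun i => hT i A hA hd hU

lemma tendsto_sum_of_tendsto_remainder {V : Type*} [NormedAddCommGroup V] {T : Set S → V}
    (h : IsDeltaRing 𝒮) (h0 : T ∅ = 0)
    (hT : ∀ A ∈ 𝒮, ∀ B ∈ 𝒮, Disjoint A B → T (A ∪ B) = T A + T B) {A : ℕ → Set S}
    (hA : ∀ n, A n ∈ 𝒮) (hd : Pairwise (fun i j => Disjoint (A i) (A j)))
    (hU : (⋃ n, A n) ∈ 𝒮)
    (hR : Tendsto (fun N : ℕ => T ((⋃ n, A n) \ ⋃ n ∈ Finset.range N, A n)) atTop (𝓝 0)) :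
    Tendsto (fun N : ℕ => ∑ n ∈ Finset.range N, T (A n)) atTop (𝓝 (T (⋃ n, A n))) := by
  have hB : ∀ N, (⋃ n ∈ Finset.range N, A n) ∈ 𝒮 := fun N =>
    h.isSetRing.biUnion_mem _ fun n _ => hA n
  have h1 : ∀ N, ∑ n ∈ Finset.range N, T (A n) =
      T (⋃ n, A n) - T ((⋃ n, A n) \ ⋃ n ∈ Finset.range N, A n) := fun N => by
    have := hT _ (hB N) _ (h.isSetRing.sdiff_mem hU (hB N)) Set.disjoint_sdiff_right
    rw [Set.union_sdiff_cancel (Set.iUnion₂_subset fun n _ => Set.subset_iUnion A n)] at this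
    rw [this, map_biUnion_range h h0 hT hA hd, add_sub_cancel_right]
  simp only [h1]
  simpa using hR.const_sub (T (⋃ n, A n))

/-- The characteristics of an independently scattered random measure vanish asymptotically on the
remainders of a disjoint union, and the Lévy measures are `σ`-additive. -/
lemma IsISRM.triplet_remainder (h : IsDeltaRing 𝒮) (hM : IsISRM 𝒮 P M)
    (hid : ∀ A ∈ 𝒮, HasLevyTriplet (P.map (M A)) (γ A) (Q A) (φ A)) {A : ℕ → Set S}
    (hA : ∀ n, A n ∈ 𝒮) (hd : Pairwise (fun i j => Disjoint (A i) (A j)))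
    (hU : (⋃ n, A n) ∈ 𝒮) :
    φ (⋃ n, A n) = Measure.sum (fun n => φ (A n)) ∧
      Tendsto (fun N : ℕ => γ ((⋃ n, A n) \ ⋃ n ∈ Finset.range N, A n)) atTop (𝓝 0) ∧
      Tendsto (fun N : ℕ => (Q ((⋃ n, A n) \ ⋃ n ∈ Finset.range N, A n)).trace) atTop (𝓝 0) := by
  set U := ⋃ n, A n
  set R : ℕ → Set S := fun N => U \ ⋃ n ∈ Finset.range N, A n
  have hB : ∀ N, (⋃ n ∈ Finset.range N, A n) ∈ 𝒮 := fun N =>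
    h.isSetRing.biUnion_mem _ fun n _ => hA n
  have hR : ∀ N, R N ∈ 𝒮 := fun N => h.isSetRing.sdiff_mem hU (hB N)
  have hUR : ∀ N, (⋃ n ∈ Finset.range N, A n) ∪ R N = U := fun N =>
    Set.union_sdiff_cancel (Set.iUnion₂_subset fun n _ => Set.subset_iUnion A n)
  have hφR : ∀ N, φ U = ∑ n ∈ Finset.range N, φ (A n) + φ (R N) := fun N => by
    rw [← map_biUnion_range h (hM.triplet_empty h hid).2.2
      (fun A hA B hB hAB => (hM.triplet_union h hid hA hB hAB).2.2) hA hd, ← hUR N]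
    exact (hM.triplet_union h hid (hB N) (hR N) Set.disjoint_sdiff_right).2.2
  have hmom : ∀ A ∈ 𝒮, truncatedSecondMoment (φ A) ≠ ∞ := fun A hA =>
    (hid A hA).isLevyMeasure.moment_lt_top.ne
  have hexp : ∀ t, Tendsto (fun N => Complex.exp
      (levyKhintchineExponent (γ (R N)) (Q (R N)) (φ (R N)) t)) atTop (𝓝 1) := fun t => by
    refine (tendsto_charFun_of_tendsto_zero (fun N => hM.measurable _ (hR N))
      (hM.tendsto_remainder h hA hd hU) t).congr fun N => ?_
    exact (hid _ (hR N)).charFun_eq t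
  -- The modulus of the characteristic function sees only the real part, so no branch of the complex
  -- logarithm is involved.
  have hre : ∀ t, Tendsto (fun N => (1 / 2) * inner ℝ (Matrix.toEuclideanLin (Q (R N)) t) t +
      (∫⁻ x, cosWeight t x ∂φ (R N)).toReal) atTop (𝓝 (0 : ℝ)) := fun t => by
    have h1 := (hexp t).norm
    simp only [Complex.norm_exp, norm_one] at h1
    have h2 := ((Real.continuousAt_log one_ne_zero).tendsto.comp h1).neg
    simp only [Function.comp_def, Real.log_exp, Real.log_one, neg_zero] at h2
    exact h2.congr fun N => neg_re_levyKhintchineExponent (hmom _ (hR N)) t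
  have hqnn : ∀ N t, 0 ≤ (1 / 2) * (inner ℝ (Matrix.toEuclideanLin (Q (R N)) t) t : ℝ) :=
    fun N t => mul_nonneg (by norm_num)
      ((Matrix.isPositive_toEuclideanLin_iff.2 (hid _ (hR N)).posSemidef).inner_nonneg_left t)
  have hq : ∀ t, Tendsto (fun N => (1 / 2) * inner ℝ (Matrix.toEuclideanLin (Q (R N)) t) t) atTop
      (𝓝 (0 : ℝ)) := fun t => squeeze_zero (fun N => hqnn N t)
    (fun N => le_add_of_nonneg_right ENNReal.toReal_nonneg) (hre t)
  have hcfin : ∀ N t, ∫⁻ x, cosWeight t x ∂φ (R N) ≠ ∞ := fun N t => by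
    rw [lintegral_cosWeight (hmom _ (hR N))]; exact ENNReal.ofReal_ne_top
  have hc : ∀ t, Tendsto (fun N => ∫⁻ x, cosWeight t x ∂φ (R N)) atTop (𝓝 0) := fun t => by
    rw [← ENNReal.tendsto_toReal_iff (fun N => hcfin N t) ENNReal.zero_ne_top]
    exact squeeze_zero (fun N => ENNReal.toReal_nonneg)
      (fun N => le_add_of_nonneg_left (hqnn N t)) (hre t)
  have hφU : φ U = Measure.sum fun n => φ (A n) := by
    -- Under each cosine weight the mass on the remainder tends to `0`, so the weighted measures add
    -- up.
    refine eq_of_cosWeight_eq (hid U hU).isLevyMeasure.zero ?_ fun t => ?_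
    · rw [Measure.sum_apply _ (measurableSet_singleton 0)]
      simp [fun n => (hid _ (hA n)).isLevyMeasure.zero]
    · ext B hB
      rw [withDensity_sum, Measure.sum_apply _ hB]
      have h1 : ∀ N, (φ U).withDensity (cosWeight t) B =
          ∑ n ∈ Finset.range N, (φ (A n)).withDensity (cosWeight t) B +
            (φ (R N)).withDensity (cosWeight t) B := fun N => by
        simp only [withDensity_apply _ hB]
        rw [hφR N, Measure.restrict_add, lintegral_add_measure, ← Measure.sum_coe_finset,
          Measure.restrict_sum _ hB, lintegral_sum_measure]
        simp [Finset.sum_attach (Finset.range N) fun n => ∫⁻ x in B, cosWeight t x ∂φ (A n)]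
      have h2 : Tendsto (fun N => (φ (R N)).withDensity (cosWeight t) B) atTop (𝓝 0) := by
        refine tendsto_of_tendsto_of_tendsto_of_le_of_le tendsto_const_nhds (hc t)
          (fun N => zero_le) fun N => ?_
        simp only [withDensity_apply _ hB]
        exact setLIntegral_le_lintegral _ _
      have h3 := (ENNReal.tendsto_nat_tsum
        (fun n => (φ (A n)).withDensity (cosWeight t) B)).add h2
      simp only [← h1, add_zero] at h3
      exact tendsto_nhds_unique tendsto_const_nhds h3
  -- With `φ U` identified as a sum, the moments on the remainders are tails of a convergent series.
  have hmomR : Tendsto (fun N => (truncatedSecondMoment (φ (R N))).toReal) atTop (𝓝 0) := by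
    have h1 : ∀ N, (truncatedSecondMoment (φ (R N))).toReal = (truncatedSecondMoment (φ U)).toReal -
        ∑ n ∈ Finset.range N, (truncatedSecondMoment (φ (A n))).toReal := fun N => by
      have h2 : truncatedSecondMoment (φ U) = ∑ n ∈ Finset.range N,
          truncatedSecondMoment (φ (A n)) + truncatedSecondMoment (φ (R N)) := by
        rw [← map_biUnion_range (T := fun A => truncatedSecondMoment (φ A)) h
          (by simp [(hM.triplet_empty h hid).2.2, truncatedSecondMoment])
          (fun A hA B hB hAB => by
            rw [(hM.triplet_union h hid hA hB hAB).2.2, truncatedSecondMoment_add]) hA hd, ← hUR N,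
          (hM.triplet_union h hid (hB N) (hR N) Set.disjoint_sdiff_right).2.2,
          truncatedSecondMoment_add]
      rw [h2, ENNReal.toReal_add (ENNReal.sum_ne_top.2 fun n _ => hmom _ (hA n)) (hmom _ (hR N)),
        ENNReal.toReal_sum fun n _ => hmom _ (hA n), add_sub_cancel_left]
    have h3 : truncatedSecondMoment (φ U) = ∑' n, truncatedSecondMoment (φ (A n)) := by
      unfold truncatedSecondMoment
      rw [hφU, lintegral_sum_measure]
    have h4 : HasSum (fun n => (truncatedSecondMoment (φ (A n))).toReal)
        (truncatedSecondMoment (φ U)).toReal := by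
      rw [h3, ENNReal.tsum_toReal_eq fun n => hmom _ (hA n)]
      exact ENNReal.hasSum_toReal (by rw [← h3]; exact hmom _ hU)
    simp only [h1]
    simpa using h4.tendsto_sum_nat.const_sub (truncatedSecondMoment (φ U)).toReal
  refine ⟨hφU, tendsto_zero_of_tendsto_exp_inner fun t => ?_, ?_⟩
  · have hI : Tendsto (fun N => ∫ x, levyIntegrand t x ∂φ (R N)) atTop (𝓝 0) :=
      squeeze_zero_norm (fun N => norm_integral_levyIntegrand_le (hmom _ (hR N)) t)
        (by simpa using hmomR.const_mul (levyBound ‖t‖))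
    have hq' : Tendsto (fun N => (((1 / 2) * inner ℝ (Matrix.toEuclideanLin (Q (R N)) t) t : ℝ) : ℂ))
        atTop (𝓝 0) := by
      have := (Complex.continuous_ofReal.tendsto 0).comp (hq t)
      rwa [Complex.ofReal_zero] at this
    -- Multiplying by a factor that tends to `1` cancels the Gaussian and Lévy parts and isolates
    -- `exp (i⟨γ, t⟩)`.
    have h1 := (hexp t).mul ((Complex.continuous_exp.tendsto _).comp (hq'.sub hI))
    simp only [Function.comp_def, sub_zero, Complex.exp_zero, mul_one, ← Complex.exp_add] at h1
    refine h1.congr fun N => congrArg Complex.exp ?_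
    rw [levyKhintchineExponent]
    push_cast
    ring
  · have h1 : ∀ N, (Q (R N)).trace = ∑ i, 2 * ((1 / 2) * inner ℝ (Matrix.toEuclideanLin (Q (R N))
        (EuclideanSpace.single i 1)) (EuclideanSpace.single i 1)) := fun N => by
      refine Finset.sum_congr rfl fun i _ => ?_
      simp [Matrix.toLpLin_apply, EuclideanSpace.inner_single_right]
    refine Tendsto.congr (fun N => (h1 N).symm) ?_
    have h2 := tendsto_finsetSum Finset.univ fun i (_ : i ∈ Finset.univ) =>
      (hq (EuclideanSpace.single i 1)).const_mul 2
    rwa [mul_zero, Finset.sum_const_zero] at h2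

lemma IsISRM.isSigmaAdditive_shift (h : IsDeltaRing 𝒮) (hM : IsISRM 𝒮 P M)
    (hid : ∀ A ∈ 𝒮, HasLevyTriplet (P.map (M A)) (γ A) (Q A) (φ A)) :
    IsSigmaAdditive 𝒮 γ := by
  refine isSigmaAdditive_euclidean fun i => isSigmaAdditive_real h
    (by simp [(hM.triplet_empty h hid).1]) fun A hA hd hU => ?_
  have h1 := tendsto_sum_of_tendsto_remainder h (hM.triplet_empty h hid).1
    (fun A hA B hB hAB => (hM.triplet_union h hid hA hB hAB).1) hA hd hU
    (hM.triplet_remainder h hid hA hd hU).2.1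
  have h2 := ((EuclideanSpace.proj i : EuclideanSpace ℝ (Fin m) →L[ℝ] ℝ).continuous.tendsto _).comp
    h1
  simpa [Function.comp_def] using h2

/-- On the remainders the trace tends to `0`, and it bounds every entry of a positive semidefinite
matrix. -/
lemma IsISRM.isSigmaAdditive_covariance (h : IsDeltaRing 𝒮) (hM : IsISRM 𝒮 P M)
    (hid : ∀ A ∈ 𝒮, HasLevyTriplet (P.map (M A)) (γ A) (Q A) (φ A))
    (i j : Fin m) :
    IsSigmaAdditive 𝒮 fun A => Q A i j := by
  refine isSigmaAdditive_real h
    (by simp [(hM.triplet_empty h hid).2.1]) fun A hA hd hU => ?_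
  refine tendsto_sum_of_tendsto_remainder (T := fun A => Q A i j) h
    (by simp [(hM.triplet_empty h hid).2.1])
    (fun A hA B hB hAB => by rw [(hM.triplet_union h hid hA hB hAB).2.1, Matrix.add_apply])
    hA hd hU ?_
  refine squeeze_zero_norm (fun N => ?_) (hM.triplet_remainder h hid hA hd hU).2.2
  exact abs_apply_le_trace (hid _ (h.isSetRing.sdiff_mem hU
    (h.isSetRing.biUnion_mem _ fun n _ => hA n))).posSemidef i j

lemma IsISRM.isSigmaAdditive_levyMeasure (h : IsDeltaRing 𝒮) (hM : IsISRM 𝒮 P M)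
    (hid : ∀ A ∈ 𝒮, HasLevyTriplet (P.map (M A)) (γ A) (Q A) (φ A))
    {B : Set (EuclideanSpace ℝ (Fin m))}
    (hB : MeasurableSet B) : IsSigmaAdditive 𝒮 fun A => φ A B := by
  intro A hA hd hU
  beta_reduce
  rw [(hM.triplet_remainder h hid hA hd hU).1, Measure.sum_apply _ hB]
  exact ENNReal.summable.hasSum

lemma IsISRM.isSigmaAdditive_truncatedSecondMoment (h : IsDeltaRing 𝒮) (hM : IsISRM 𝒮 P M)
    (hid : ∀ A ∈ 𝒮, HasLevyTriplet (P.map (M A)) (γ A) (Q A) (φ A)) :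
    IsSigmaAdditive 𝒮 fun A => truncatedSecondMoment (φ A) := by
  intro A hA hd hU
  unfold truncatedSecondMoment
  beta_reduce
  rw [(hM.triplet_remainder h hid hA hd hU).1, lintegral_sum_measure]
  exact ENNReal.summable.hasSum

end sigmaAdditivity

/-! ### Densities, the exponent kernel and the control measure. -/

section controlMeasure

variable {S : Type*} [mS : MeasurableSpace S] {m : ℕ} {𝒮 : Set (Set S)} {lam : Measure S}
  {γ : Set S → EuclideanSpace ℝ (Fin m)} {Q : Set S → Matrix (Fin m) (Fin m) ℝ}
  {φ : Set S → Measure (EuclideanSpace ℝ (Fin m))}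

/-! ### Densities -/

lemma IsDeltaRing.ae_eq_of_setIntegral_eq (h : IsDeltaRing 𝒮)
    (hσ : mS = MeasurableSpace.generateFrom 𝒮) {f g : S → ℝ}
    (hf : ∀ A ∈ 𝒮, IntegrableOn f A lam) (hg : ∀ A ∈ 𝒮, IntegrableOn g A lam)
    (heq : ∀ A ∈ 𝒮, ∫ s in A, f s ∂lam = ∫ s in A, g s ∂lam) : f =ᵐ[lam] g := by
  refine h.ae_of_forall_restrict fun A hA => ?_
  -- The test sets are `X ∩ A` with `X` measurable, and these lie in `𝒮`.
  refine Integrable.ae_eq_of_forall_setIntegral_eq f g (hf A hA) (hg A hA) fun X hX _ => ?_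
  rw [Measure.restrict_restrict hX]
  exact heq _ (h.inter_measurableSet_mem hσ hX hA)

lemma IsDeltaRing.ae_nonneg_of_setIntegral_nonneg (h : IsDeltaRing 𝒮)
    (hσ : mS = MeasurableSpace.generateFrom 𝒮) {f : S → ℝ}
    (hf : ∀ A ∈ 𝒮, IntegrableOn f A lam)
    (hnn : ∀ A ∈ 𝒮, 0 ≤ ∫ s in A, f s ∂lam) : ∀ᵐ s ∂lam, 0 ≤ f s := by
  refine h.ae_of_forall_restrict fun A hA => ?_
  refine ae_nonneg_of_forall_setIntegral_nonneg (hf A hA) fun X hX _ => ?_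
  rw [Measure.restrict_restrict hX]
  exact hnn _ (h.inter_measurableSet_mem hσ hX hA)

lemma IsVectorDensity.ae_eq (h : IsDeltaRing 𝒮) (hσ : mS = MeasurableSpace.generateFrom 𝒮)
    {α α' : S → EuclideanSpace ℝ (Fin m)} (hα : IsVectorDensity 𝒮 lam γ α)
    (hα' : IsVectorDensity 𝒮 lam γ α') : α =ᵐ[lam] α' := by
  have h1 : ∀ᵐ s ∂lam, ∀ i, α s i = α' s i := ae_all_iff.2 fun i =>
    h.ae_eq_of_setIntegral_eq hσ (fun A hA => hα.integrableOn A hA i)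
      (fun A hA => hα'.integrableOn A hA i)
      (fun A hA => by rw [hα.integral_eq A hA i, hα'.integral_eq A hA i])
  filter_upwards [h1] with s hs
  ext i
  exact hs i

lemma IsMatrixDensity.ae_eq (h : IsDeltaRing 𝒮) (hσ : mS = MeasurableSpace.generateFrom 𝒮)
    {β β' : S → Matrix (Fin m) (Fin m) ℝ} (hβ : IsMatrixDensity 𝒮 lam Q β)
    (hβ' : IsMatrixDensity 𝒮 lam Q β') : β =ᵐ[lam] β' := by
  have h1 : ∀ᵐ s ∂lam, ∀ i j, β s i j = β' s i j := ae_all_iff.2 fun i => ae_all_iff.2 fun j =>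
    h.ae_eq_of_setIntegral_eq hσ (fun A hA => hβ.integrableOn A hA i j)
      (fun A hA => hβ'.integrableOn A hA i j)
      (fun A hA => by rw [hβ.integral_eq A hA i j, hβ'.integral_eq A hA i j])
  filter_upwards [h1] with s hs
  ext i j
  exact hs i j

lemma integrable_bilin {μ : Measure S} {β : S → Matrix (Fin m) (Fin m) ℝ}
    (hβ : ∀ i j, Integrable (fun s => β s i j) μ) (v : Fin m → ℝ) :
    Integrable (fun s => v ⬝ᵥ (β s).mulVec v) μ := by
  simp only [dotProduct, Matrix.mulVec]
  exact integrable_finsetSum _ fun i _ => (integrable_finsetSum _ fun j _ =>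
    (hβ i j).mul_const _).const_mul _

lemma integral_bilin {μ : Measure S} {β : S → Matrix (Fin m) (Fin m) ℝ}
    {R : Matrix (Fin m) (Fin m) ℝ}
    (hβ : ∀ i j, Integrable (fun s => β s i j) μ) (hR : ∀ i j, ∫ s, β s i j ∂μ = R i j)
    (v : Fin m → ℝ) :
    ∫ s, v ⬝ᵥ (β s).mulVec v ∂μ = v ⬝ᵥ R.mulVec v := by
  simp only [dotProduct, Matrix.mulVec]
  rw [integral_finsetSum]
  · refine Finset.sum_congr rfl fun i _ => ?_
    rw [integral_const_mul, integral_finsetSum]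
    · simp only [integral_mul_const, hR]
    · exact fun j _ => (hβ i j).mul_const _
  · exact fun i _ => (integrable_finsetSum _ fun j _ => (hβ i j).mul_const _).const_mul _

/-- For a fixed vector, nonnegative integrals over all of `𝒮` give a nonnegative form almost
everywhere. A countable dense set of vectors merges the null sets, and continuity of the form covers
the rest. -/
lemma IsMatrixDensity.ae_posSemidef (h : IsDeltaRing 𝒮)
    (hσ : mS = MeasurableSpace.generateFrom 𝒮) (hQ : ∀ A ∈ 𝒮, (Q A).PosSemidef)
    {β : S → Matrix (Fin m) (Fin m) ℝ} (hβ : IsMatrixDensity 𝒮 lam Q β) :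
    ∀ᵐ s ∂lam, (β s).PosSemidef := by
  have h1 : ∀ᵐ s ∂lam, ∀ i j, β s j i = β s i j := ae_all_iff.2 fun i => ae_all_iff.2 fun j =>
    h.ae_eq_of_setIntegral_eq hσ (fun A hA => hβ.integrableOn A hA j i)
      (fun A hA => hβ.integrableOn A hA i j)
      (fun A hA => by
        rw [hβ.integral_eq A hA j i, hβ.integral_eq A hA i j]
        simpa using (hQ A hA).isHermitian.apply i j)
  have h2 : ∀ᵐ s ∂lam, ∀ n, 0 ≤ TopologicalSpace.denseSeq (Fin m → ℝ) n ⬝ᵥ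
      (β s).mulVec (TopologicalSpace.denseSeq (Fin m → ℝ) n) := ae_all_iff.2 fun n =>
    h.ae_nonneg_of_setIntegral_nonneg hσ
      (fun A hA => integrable_bilin (hβ.integrableOn A hA) _)
      (fun A hA => by
        rw [integral_bilin (hβ.integrableOn A hA) (hβ.integral_eq A hA)]
        simpa using (hQ A hA).dotProduct_mulVec_nonneg
          (TopologicalSpace.denseSeq (Fin m → ℝ) n))
  filter_upwards [h1, h2] with s hs hs'
  refine Matrix.PosSemidef.of_dotProduct_mulVec_nonneg (Matrix.IsHermitian.ext fun i j => ?_)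
    fun v => ?_
  · simpa using hs i j
  · rw [star_trivial]
    refine (TopologicalSpace.denseRange_denseSeq (Fin m → ℝ)).induction_on
      (p := fun v => 0 ≤ v ⬝ᵥ (β s).mulVec v) v ?_ hs'
    refine isClosed_le continuous_const ?_
    exact continuous_id.dotProduct (Continuous.matrix_mulVec continuous_const continuous_id)

lemma exists_isVectorDensity (h : IsDeltaRing 𝒮) (hσ : mS = MeasurableSpace.generateFrom 𝒮)
    (hγ : IsSigmaAdditive 𝒮 γ) (hfin : ∀ A ∈ 𝒮, lam A ≠ ∞) (hle : ∀ A ∈ 𝒮, ‖γ A‖ₑ ≤ lam A) :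
    ∃ α, IsVectorDensity 𝒮 lam γ α := by
  have h1 : ∀ i, ∃ f : S → ℝ, Measurable f ∧ ∀ A ∈ 𝒮, IntegrableOn f A lam ∧
      ∫ s in A, f s ∂lam = γ A i := fun i => by
    refine IsSigmaAdditive.exists_density h hσ (fun A hA hd hU => ?_) hfin fun A hA => ?_
    · exact (hγ A hA hd hU).mapL (EuclideanSpace.proj i : EuclideanSpace ℝ (Fin m) →L[ℝ] ℝ)
    · refine (PiLp.norm_apply_le (γ A) i).trans ?_
      rw [← toReal_enorm]
      exact ENNReal.toReal_mono (hfin A hA) (hle A hA)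
  choose f hf hfA using h1
  refine ⟨fun s => WithLp.toLp 2 fun i => f i s, ?_, fun A hA i => (hfA i A hA).1,
    fun A hA i => (hfA i A hA).2⟩
  exact (WithLp.measurable_toLp 2 (Fin m → ℝ)).comp (measurable_pi_lambda _ hf)

lemma exists_isMatrixDensity (h : IsDeltaRing 𝒮) (hσ : mS = MeasurableSpace.generateFrom 𝒮)
    (hQ : ∀ i j, IsSigmaAdditive 𝒮 fun A => Q A i j) (hpsd : ∀ A ∈ 𝒮, (Q A).PosSemidef)
    (hfin : ∀ A ∈ 𝒮, lam A ≠ ∞) (hle : ∀ A ∈ 𝒮, ENNReal.ofReal (Q A).trace ≤ lam A) :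
    ∃ β, IsMatrixDensity 𝒮 lam Q β := by
  have h1 : ∀ i j, ∃ f : S → ℝ, Measurable f ∧ ∀ A ∈ 𝒮, IntegrableOn f A lam ∧
      ∫ s in A, f s ∂lam = Q A i j := fun i j => by
    refine (hQ i j).exists_density h hσ hfin fun A hA => ?_
    refine (abs_apply_le_trace (hpsd A hA) i j).trans ?_
    rw [← ENNReal.toReal_ofReal (hpsd A hA).trace_nonneg]
    exact ENNReal.toReal_mono (hfin A hA) (hle A hA)
  choose f hf hfA using h1
  exact ⟨fun s => Matrix.of fun i j => f i j s, hf, fun A hA i j => (hfA i j A hA).1,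
    fun A hA i j => (hfA i j A hA).2⟩

/-! ### The exponent kernel -/

/-- `φ A` as a mixture of the `ρ s`. Composition with a constant kernel from `Unit` gives access to
Fubini for composed kernels. -/
lemma IsLevyTransition.bind_eq
    {ρ : Kernel S (EuclideanSpace ℝ (Fin m))} (hρ : IsLevyTransition 𝒮 φ lam ρ) {A : Set S}
    (hA : A ∈ 𝒮) : (ρ ∘ₖ Kernel.const Unit (lam.restrict A)) () = φ A := by
  ext B hB
  rw [Kernel.comp_apply, Kernel.const_apply, Measure.bind_apply hB ρ.measurable.aemeasurable]
  exact hρ.lintegral_eq A hA B hB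

/-- An arbitrary version `ρ` need not be normalized, but its moments integrate over `A` to the
finite moment of `φ A`. -/
lemma IsLevyTransition.ae_moment_lt_top (h : IsDeltaRing 𝒮)
    (hφ : ∀ A ∈ 𝒮, IsLevyMeasure (φ A))
    {ρ : Kernel S (EuclideanSpace ℝ (Fin m))} (hρ : IsLevyTransition 𝒮 φ lam ρ) :
    ∀ᵐ s ∂lam, truncatedSecondMoment (ρ s) < ∞ := by
  refine h.ae_of_forall_restrict fun A hA => ?_
  have hm := measurable_truncation (m := m)
  refine ae_lt_top hm.lintegral_kernel ?_
  have h1 := Kernel.lintegral_comp ρ (Kernel.const Unit (lam.restrict A)) () hm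
  rw [hρ.bind_eq hA, Kernel.const_apply] at h1
  unfold truncatedSecondMoment
  rw [← h1]
  exact (hφ A hA).moment_lt_top.ne

/-- The integral of the exponent kernel over a set is the exponent of the set. -/
lemma integral_expKernel (hφ : ∀ A ∈ 𝒮, IsLevyMeasure (φ A)) {α : S → EuclideanSpace ℝ (Fin m)}
    {β : S → Matrix (Fin m) (Fin m) ℝ} {ρ : Kernel S (EuclideanSpace ℝ (Fin m))}
    (hα : IsVectorDensity 𝒮 lam γ α) (hβ : IsMatrixDensity 𝒮 lam Q β)
    (hρ : IsLevyTransition 𝒮 φ lam ρ) {A : Set S} (hA : A ∈ 𝒮) (t : EuclideanSpace ℝ (Fin m)) :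
    IntegrableOn (expKernel α β ρ t) A lam ∧
      ∫ s in A, expKernel α β ρ t s ∂lam = levyKhintchineExponent (γ A) (Q A) (φ A) t := by
  have e1 : ∀ x : EuclideanSpace ℝ (Fin m), (inner ℝ x t : ℝ) = ∑ i, x i * t i := fun x => by
    simp [PiLp.inner_apply, mul_comm]
  have e2 : ∀ R : Matrix (Fin m) (Fin m) ℝ, (inner ℝ (Matrix.toEuclideanLin R t) t : ℝ) =
      t.ofLp ⬝ᵥ R.mulVec t.ofLp := fun R => by
    simp [PiLp.inner_apply, dotProduct, Matrix.toLpLin_apply]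
  have i1 : Integrable (fun s => (inner ℝ (α s) t : ℝ)) (lam.restrict A) := by
    simp only [e1]
    exact integrable_finsetSum _ fun i _ => (hα.integrableOn A hA i).mul_const _
  have v1 : ∫ s in A, (inner ℝ (α s) t : ℝ) ∂lam = inner ℝ (γ A) t := by
    simp only [e1]
    rw [integral_finsetSum _ fun i _ => (hα.integrableOn A hA i).mul_const _]
    simp only [integral_mul_const, hα.integral_eq A hA]
  have i2 : Integrable (fun s => (inner ℝ (Matrix.toEuclideanLin (β s) t) t : ℝ))
      (lam.restrict A) := by
    simp only [e2]
    exact integrable_bilin (hβ.integrableOn A hA) _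
  have v2 : ∫ s in A, (inner ℝ (Matrix.toEuclideanLin (β s) t) t : ℝ) ∂lam =
      inner ℝ (Matrix.toEuclideanLin (Q A) t) t := by
    simp only [e2]
    exact integral_bilin (hβ.integrableOn A hA) (hβ.integral_eq A hA) _
  -- Integrability against the mixture `φ A` supplies both the integrability of the inner integral
  -- in `s` and the exchange of integrals.
  have i0 : Integrable (levyIntegrand t) ((ρ ∘ₖ Kernel.const Unit (lam.restrict A)) ()) := by
    rw [hρ.bind_eq hA]
    exact integrable_levyIntegrand (hφ A hA).moment_lt_top.ne t
  have i3 : Integrable (fun s => ∫ x, levyIntegrand t x ∂ρ s) (lam.restrict A) := by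
    simpa using i0.integral_comp
  have v3 : ∫ s in A, ∫ x, levyIntegrand t x ∂ρ s ∂lam = ∫ x, levyIntegrand t x ∂φ A := by
    have := Kernel.integral_comp i0
    rw [hρ.bind_eq hA, Kernel.const_apply] at this
    exact this.symm
  have j1 : Integrable (fun s => Complex.I * ((inner ℝ (α s) t : ℝ) : ℂ)) (lam.restrict A) :=
    i1.ofReal.const_mul _
  have j2 : Integrable (fun s => (1 / 2 : ℂ) * ((inner ℝ (Matrix.toEuclideanLin (β s) t) t : ℝ) : ℂ))
      (lam.restrict A) := i2.ofReal.const_mul _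
  refine ⟨(j1.sub j2).add i3, ?_⟩
  simp only [expKernel, levyKhintchineExponent]
  rw [integral_add (by exact j1.sub j2) i3, integral_sub j1 j2, integral_const_mul,
    integral_const_mul, integral_complex_ofReal, integral_complex_ofReal, v1, v2, v3]

end controlMeasure

/-- All three summands are `σ`-additive. Finiteness on `𝒮` is recorded because `σ`-finiteness,
uniqueness and the densities rest on it; for the variation it comes from the components of `γ`. -/
lemma exists_controlMeasure {S Ω : Type*} [mS : MeasurableSpace S] [MeasurableSpace Ω] {m : ℕ}
    {𝒮 : Set (Set S)} (h : IsDeltaRing 𝒮) (hσ : mS = MeasurableSpace.generateFrom 𝒮)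
    {P : Measure Ω} [IsProbabilityMeasure P] {M : Set S → Ω → EuclideanSpace ℝ (Fin m)}
    (hM : IsISRM 𝒮 P M) {γ : Set S → EuclideanSpace ℝ (Fin m)}
    {Q : Set S → Matrix (Fin m) (Fin m) ℝ} {φ : Set S → Measure (EuclideanSpace ℝ (Fin m))}
    (hid : ∀ A ∈ 𝒮, HasLevyTriplet (P.map (M A)) (γ A) (Q A) (φ A)) :
    ∃ lam : Measure S, IsControlMeasure 𝒮 γ Q φ lam ∧ ∀ A ∈ 𝒮, lam A ≠ ∞ := by
  have hγ := hM.isSigmaAdditive_shift h hid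
  have hQ := hM.isSigmaAdditive_covariance h hid
  obtain ⟨e1, e2, e3⟩ := hM.triplet_empty h hid
  have htr : IsSigmaAdditive 𝒮 fun A => ENNReal.ofReal (Q A).trace := by
    intro A hA hd hU
    have h1 : HasSum (fun n => (Q (A n)).trace) (Q (⋃ n, A n)).trace :=
      hasSum_sum fun i _ => hQ i i A hA hd hU
    beta_reduce
    rw [← h1.tsum_eq, ENNReal.ofReal_tsum_of_nonneg
      (fun n => (hid _ (hA n)).posSemidef.trace_nonneg) h1.summable]
    exact ENNReal.summable.hasSum
  have hadd : IsSigmaAdditive 𝒮 fun A => totalVariation 𝒮 γ A + ENNReal.ofReal (Q A).trace +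
      truncatedSecondMoment (φ A) := fun A hA hd hU =>
    ((hγ.isSigmaAdditive_totalVariation h A hA hd hU).add (htr A hA hd hU)).add
      (hM.isSigmaAdditive_truncatedSecondMoment h hid A hA hd hU)
  obtain ⟨lam, hlam⟩ := hadd.exists_measure h hσ
    (by simp [totalVariation_empty e1, e2, e3, truncatedSecondMoment])
  refine ⟨lam, hlam, fun A hA => ?_⟩
  rw [hlam A hA]
  refine ENNReal.add_ne_top.2 ⟨ENNReal.add_ne_top.2 ⟨?_, ENNReal.ofReal_ne_top⟩,
    (hid A hA).isLevyMeasure.moment_lt_top.ne⟩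
  refine ne_top_of_le_ne_top ?_ (totalVariation_euclidean_le A)
  refine ENNReal.sum_ne_top.2 fun i _ => ?_
  refine (IsSigmaAdditive.totalVariation_lt_top h hσ (fun B hB hd hU => ?_) hA).ne
  exact (hγ B hB hd hU).mapL (EuclideanSpace.proj i : EuclideanSpace ℝ (Fin m) →L[ℝ] ℝ)

end ISRM

end

/-! ### The theorem. -/

theorem proposition29031701 {S Ω : Type*} [mS : MeasurableSpace S] [MeasurableSpace Ω] {m : ℕ}
    (𝒮 : Set (Set S)) (h𝒮 : ISRM.IsDeltaRing 𝒮) (hσ : mS = MeasurableSpace.generateFrom 𝒮)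
    (P : Measure Ω) [IsProbabilityMeasure P]
    (M : Set S → Ω → EuclideanSpace ℝ (Fin m)) (hM : ISRM.IsISRM 𝒮 P M)
    (γ : Set S → EuclideanSpace ℝ (Fin m)) (Q : Set S → Matrix (Fin m) (Fin m) ℝ)
    (φ : Set S → Measure (EuclideanSpace ℝ (Fin m)))
    (hid : ∀ A ∈ 𝒮, ISRM.HasLevyTriplet (P.map (M A)) (γ A) (Q A) (φ A)) :
    -- the control measure exists and is unique
    ∃ lam : Measure S, SigmaFinite lam ∧ ISRM.IsControlMeasure 𝒮 γ Q φ lam ∧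
      (∀ lam' : Measure S, ISRM.IsControlMeasure 𝒮 γ Q φ lam' → lam' = lam) ∧
      -- the transition function exists, also with the usual normalization
      (∃ ρ : Kernel S (EuclideanSpace ℝ (Fin m)), ISRM.IsLevyTransition 𝒮 φ lam ρ ∧
        ∀ s, ISRM.truncatedSecondMoment (ρ s) ≤ 1) ∧
      -- existence and uniqueness of the densities
      (∃ α, ISRM.IsVectorDensity 𝒮 lam γ α) ∧
      (∃ β, ISRM.IsMatrixDensity 𝒮 lam Q β) ∧
      (∀ α α', ISRM.IsVectorDensity 𝒮 lam γ α → ISRM.IsVectorDensity 𝒮 lam γ α' →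
        α =ᵐ[lam] α') ∧
      (∀ β β', ISRM.IsMatrixDensity 𝒮 lam Q β → ISRM.IsMatrixDensity 𝒮 lam Q β' →
        β =ᵐ[lam] β') ∧
      -- symmetry and positive semi-definiteness
      (∀ β, ISRM.IsMatrixDensity 𝒮 lam Q β → ∀ᵐ s ∂lam, (β s).PosSemidef) ∧
      -- the log-characteristic function, for all versions of the characteristics
      (∀ α β ρ, ISRM.IsVectorDensity 𝒮 lam γ α → ISRM.IsMatrixDensity 𝒮 lam Q β →
        ISRM.IsLevyTransition 𝒮 φ lam ρ →
        (∀ᵐ s ∂lam, ∀ t, Integrable (ISRM.levyIntegrand t) (ρ s)) ∧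
        ∀ A ∈ 𝒮,
          (∀ t, IntegrableOn (ISRM.expKernel α β ρ t) A lam) ∧
          ISRM.IsLogCharFun (P.map (M A)) (fun t => ∫ s in A, ISRM.expKernel α β ρ t s ∂lam)) := by
  have hφ : ∀ A ∈ 𝒮, ISRM.IsLevyMeasure (φ A) := fun A hA => (hid A hA).isLevyMeasure
  have hpsd : ∀ A ∈ 𝒮, (Q A).PosSemidef := fun A hA => (hid A hA).posSemidef
  obtain ⟨lam, hlam, hfin⟩ := ISRM.exists_controlMeasure h𝒮 hσ hM hid
  refine ⟨lam, h𝒮.sigmaFinite hfin, hlam, fun lam' hlam' => ?_, ?_, ?_, ?_,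
    fun α α' hα hα' => hα.ae_eq h𝒮 hσ hα', fun β β' hβ hβ' => hβ.ae_eq h𝒮 hσ hβ',
    fun β hβ => hβ.ae_posSemidef h𝒮 hσ hpsd, fun α β ρ hα hβ hρ => ⟨?_, fun A hA => ⟨fun t =>
      (ISRM.integral_expKernel hφ hα hβ hρ hA t).1, ?_⟩⟩⟩
  · refine (h𝒮.measure_ext hσ hfin fun A hA => ?_).symm
    rw [hlam A hA, hlam' A hA]
  · refine ISRM.exists_levyTransition h𝒮 hσ hφ (hM.triplet_empty h𝒮 hid).2.2
      (fun B hB => hM.isSigmaAdditive_levyMeasure h𝒮 hid hB) hfin fun A hA => ?_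
    rw [hlam A hA]
    exact le_add_self
  · refine ISRM.exists_isVectorDensity h𝒮 hσ (hM.isSigmaAdditive_shift h𝒮 hid) hfin fun A hA => ?_
    rw [hlam A hA, add_assoc]
    exact (ISRM.enorm_le_totalVariation hA).trans le_self_add
  · refine ISRM.exists_isMatrixDensity h𝒮 hσ (hM.isSigmaAdditive_covariance h𝒮 hid) hpsd hfin
      fun A hA => ?_
    rw [hlam A hA]
    exact le_add_self.trans le_self_add
  · filter_upwards [hρ.ae_moment_lt_top h𝒮 hφ] with s hs t
    exact ISRM.integrable_levyIntegrand hs.ne t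
  · have h1 : (fun t => ∫ s in A, ISRM.expKernel α β ρ t s ∂lam) =
        ISRM.levyKhintchineExponent (γ A) (Q A) (φ A) :=
      funext fun t => (ISRM.integral_expKernel hφ hα hβ hρ hA t).2
    rw [h1]
    exact ⟨ISRM.continuous_levyKhintchineExponent _ _ (hφ A hA).moment_lt_top.ne,
      ISRM.levyKhintchineExponent_zero _ _, (hid A hA).charFun_eq⟩
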